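/- Let $n\ge 2$, let $q\in\mathbb{C}\setminus\{0\}$, and choose $\omega\in\mathbb{C}$ with $\omega^{n^2}=q$ and a square root $\omega^{1/2}$ of $\omega$. *Quantum torus.* Let $\Theta_n=\{(a,b,c)\in\mathbb{Z}_{\ge0}^3 : a+b+c=n\}$ and let $V$ be $\Theta_n$ without its corners $(n,0,0),(0,n,0),(0,0,n)$. There is an arrow from $\nu\in V$ to $\nu'\in V$ if $\nu'-\nu\in\{(-1,0,1),(0,1,-1),(1,-1,0)\}$; its weight is $1$ if $\nu$ and $\nu'$ lie on a common side of the triangle (some coordinate vanishes at both) and $2$ otherwise. Let $P_{\nu\nu'}$ be the weight of the arrow from $\nu$ to $\nu'$ if there is one, minus the weight of the arrow from $\nu'$ to $\nu$ if there is one, and $0$ if there is neither. The Fock–Goncharov quantum torus $\mathscr{T}_n^\omega$ is the $\mathbb{C}$-algebra generated by $X_\nu^{\pm1/n}$ $(\nu\in V)$ with the relations $X_\nu^{r/n}X_{\nu'}^{s/n}=\omega^{P_{\nu\nu'}rs}X_{\nu'}^{s/n}X_\nu^{r/n}$ and $X_\nu^{r/n}X_\nu^{-r/n}=1$ for $r,s\in\mathbb{Z}$.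 The Weyl ordering is the linear map $$[-]:\mathbb{C}[X_\nu^{\pm1/n}:\nu\in V]\to\mathscr{T}_n^\omega,\qquad [X_{\nu_1}^{m_1/n}\cdots X_{\nu_k}^{m_k/n}]=(\omega^{1/2})^{-\sum_{a<b}P_{\nu_a\nu_b}m_am_b}\,X_{\nu_1}^{m_1/n}\cdots X_{\nu_k}^{m_k/n}$$ from commutative Laurent polynomials; it is applied to matrices entrywise. *Matrices.* Over a commutative algebra, for $1\le k\le n-1$ and $X, Z$ with chosen invertible $n$-th roots, put $$S^{\mathrm{left}}_k(X)=X^{-\frac{k-1}{n}}\bigl(\mathrm{diag}(\underbrace{X,\dots,X}_{k-1},1,\dots,1)+E_{k,k+1}\bigr),\qquad S^{\mathrm{right}}_k(X)=X^{\frac{k-1}{n}}\bigl(\mathrm{diag}(1,\dots,1,\underbrace{X^{-1},\dots,X^{-1}}_{k-1})+E_{n-k+1,n-k}\bigr),$$ $$S^{\mathrm{edge}}_k(Z)=Z^{-\frac{k}{n}}\,\mathrm{diag}(\underbrace{Z,\dots,Z}_{k},1,\dots,1),$$ where $S^{\mathrm{left}}_1,S^{\mathrm{right}}_1$ do not depend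 on $X$. With products of matrices written from left to right, let $M^{\mathrm{edge}}(Z_1,\dots,Z_{n-1})=S^{\mathrm{edge}}_1(Z_1)\cdots S^{\mathrm{edge}}_{n-1}(Z_{n-1})$ and $$M^{\mathrm{left}}=\prod_{k=n-1,\,n-2,\dots,1}\Bigl(S^{\mathrm{left}}_1\prod_{\ell=2}^{k}S^{\mathrm{left}}_\ell(X_{\ell-1,\,n-k,\,k-\ell+1})\Bigr),\qquad M^{\mathrm{right}}=\prod_{k=n-1,\,n-2,\dots,1}\Bigl(S^{\mathrm{right}}_1\prod_{\ell=2}^{k}S^{\mathrm{right}}_\ell(X_{k-\ell+1,\,n-k,\,\ell-1})\Bigr).$$ Put $Z_j=X_{j,0,n-j}$, $Z'_j=X_{j,n-j,0}$, $Z''_j=X_{0,j,n-j}$. The quantum left and right matrices in $\mathrm{M}_n(\mathscr{T}_n^\omega)$ are $$\mathbf{L}^\omega=[M^{\mathrm{edge}}(Z)\,M^{\mathrm{left}}\,M^{\mathrm{edge}}(Z')],\qquad \mathbf{R}^\omega=[M^{\mathrm{edge}}(Z)\,M^{\mathrm{right}}\,M^{\mathrm{edge}}(Z'')].$$ *Points.*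 For a $\mathbb{C}$-algebra $\mathscr{T}$, a matrix $M\in\mathrm{M}_n(\mathscr{T})$ is a $\mathscr{T}$-point of $\mathrm{SL}_n^q$ if every $2\times2$ submatrix $\begin{pmatrix}a&b\\c&d\end{pmatrix}$ (rows $i<j$, columns $k<m$) satisfies $$ba=qab,\quad dc=qcd,\quad ca=qac,\quad db=qbd,\quad bc=cb,\quad da-ad=(q-q^{-1})bc,$$ and $\mathrm{Det}^q(M)=\sum_{\sigma\in S_n}(-q^{-1})^{\ell(\sigma)}M_{1\sigma(1)}\cdots M_{n\sigma(n)}=1$, where $\ell(\sigma)$ is the number of inversions of $\sigma$. The algebra $\mathrm{SL}_n^q$ is generated by $n^2$ elements $m_{ij}$ subject to exactly these relations for the matrix $(m_{ij})$. **Theorem.** The matrices $\mathbf{L}^\omega$ and $\mathbf{R}^\omega$ are $\mathscr{T}_n^\omega$-points of $\mathrm{SL}_n^q$. Moreover, there is a unique $\mathbb{C}$-algebra homomorphism $\mathrm{SL}_n^q\to\mathscr{T}_n^\omega$ sending each $m_{ij}$ to $\mathbf{L}^\omega_{ij}$, and a unique one sending each $m_{ij}$ to $\mathbf{R}^\omega_{ij}$.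 -/

import Mathlib

noncomputable section

namespace FockGoncharov

/-! ### Quantum tori with `n`-th roots -/

/-- The word `X_v^{m/n}` (`m : ℤ`) in the free algebra on the letters `X_v^{1/n} = (v, true)` and
`X_v^{-1/n} = (v, false)`. -/
def freePow {V : Type} (v : V) : ℤ → FreeAlgebra ℂ (V × Bool)
  | Int.ofNat m => FreeAlgebra.ι ℂ (v, true) ^ m
  | Int.negSucc m => FreeAlgebra.ι ℂ (v, false) ^ (m + 1)

/-- The defining relations of the quantum torus of the Poisson matrix `P`. -/
inductive TorusRel {V : Type} (P : V → V → ℤ) (ω : ℂ) :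
    FreeAlgebra ℂ (V × Bool) → FreeAlgebra ℂ (V × Bool) → Prop
  | comm (v w : V) (r s : ℤ) :
      TorusRel P ω (freePow v r * freePow w s)
        (ω ^ (P v w * r * s) • (freePow w s * freePow v r))
  | inv (v : V) (r : ℤ) : TorusRel P ω (freePow v r * freePow v (-r)) 1

/-- The quantum torus (with `n`-th roots) of the Poisson matrix `P`. -/
abbrev QTorus {V : Type} (P : V → V → ℤ) (ω : ℂ) : Type := RingQuot (TorusRel P ω)

/-- The element `X_v^{m/n}` of the quantum torus. -/
def QTorus.X {V : Type} (P : V → V → ℤ) (ω : ℂ) (v : V) (m : ℤ) : QTorus P ω :=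
  RingQuot.mkAlgHom ℂ (TorusRel P ω) (freePow v m)

/-! ### Weyl ordering -/

/-- A word `X_{v₁}^{m₁/n} ⋯ X_{vₖ}^{mₖ/n}` is the list of the pairs `(vₐ, mₐ)`. This is its exponent
`∑_{a < b} P v_a v_b m_a m_b`. -/
def weylExponent {V : Type} (P : V → V → ℤ) : List (V × ℤ) → ℤ
  | [] => 0
  | x :: w => (w.map fun y => P x.1 y.1 * x.2 * y.2).sum + weylExponent P w

/-- The Weyl ordering of a word. Here `η = ω^{1/2}`, so that
`q^{-(1/2) ∑ P r_a r_b} = η^{-∑ P m_a m_b}` for `r_a = m_a / n` and `q = ω^{n²}`. -/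
def weylWord {V : Type} (P : V → V → ℤ) (ω η : ℂ) (w : List (V × ℤ)) : QTorus P ω :=
  η ^ (-weylExponent P w) • (w.map fun x => QTorus.X P ω x.1 x.2).prod

/-- The commutative Laurent polynomial algebra in the variables `X_v^{1/n}`; the exponent
`m : V →₀ ℤ` stands for the monomial `∏ X_v^{m v / n}`. -/
abbrev Laurent (V : Type) : Type := AddMonoidAlgebra ℂ (V →₀ ℤ)

/-- The Weyl ordering of Laurent polynomials: the linear map that sends a monomial to the Weyl
ordering of a word representing it (the order of the letters is irrelevant by `weylWord_perm`). -/
def weyl {V : Type} (P : V → V → ℤ) (ω η : ℂ) : Laurent V →ₗ[ℂ] QTorus P ω :=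
  Finsupp.linearCombination ℂ
      (fun m : V →₀ ℤ => weylWord P ω η (m.support.toList.map fun v => (v, m v))) ∘ₗ
    (AddMonoidAlgebra.coeffLinearEquiv ℂ).toLinearMap

theorem QTorus.X_mul_X {V : Type} (P : V → V → ℤ) (ω : ℂ) (v w : V) (r s : ℤ) :
    QTorus.X P ω v r * QTorus.X P ω w s
      = ω ^ (P v w * r * s) • (QTorus.X P ω w s * QTorus.X P ω v r) := by
  have h := RingQuot.mkAlgHom_rel ℂ (TorusRel.comm (P := P) (ω := ω) v w r s)
  simpa [QTorus.X] using h

theorem weylExponent_perm_map {V : Type} (P : V → V → ℤ) (x : V × ℤ) {w w' : List (V × ℤ)}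
    (h : w.Perm w') :
    (w.map fun y => P x.1 y.1 * x.2 * y.2).sum = (w'.map fun y => P x.1 y.1 * x.2 * y.2).sum :=
  (h.map _).sum_eq

/-- The Weyl ordering of a word does not depend on the order of its letters. -/
theorem weylWord_perm {V : Type} (P : V → V → ℤ) (hP : ∀ v w, P v w = -P w v) (ω η : ℂ)
    (hη : η ≠ 0) (hω : η ^ 2 = ω) {w w' : List (V × ℤ)} (h : w.Perm w') :
    weylWord P ω η w = weylWord P ω η w' := by
  induction h with
  | nil => rfl
  | cons x h ih =>
    simp only [weylWord, weylExponent, List.map_cons, List.prod_cons] at ih ⊢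
    rw [weylExponent_perm_map P x h, neg_add, neg_add, zpow_add₀ hη, zpow_add₀ hη,
      mul_smul, mul_smul, ← mul_smul_comm, ih, mul_smul_comm]
  | swap x y l =>
    simp only [weylWord, weylExponent, List.map_cons, List.prod_cons, List.sum_cons,
      ← mul_assoc]
    rw [QTorus.X_mul_X P ω y.1 x.1, smul_mul_assoc, smul_smul, ← hω, ← zpow_natCast, ← zpow_mul,
      ← zpow_add₀ hη, hP x.1 y.1]
    congr 2
    push_cast
    ring
  | trans _ _ ih₁ ih₂ => exact ih₁.trans ih₂

/-! ### The quiver of the discrete triangle -/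

/-- The vertices of the discrete `n`-triangle other than its three corners. -/
structure Vertex (n : ℕ) where
  a : ℕ
  b : ℕ
  c : ℕ
  sum_eq : a + b + c = n
  a_ne : a ≠ n
  b_ne : b ≠ n
  c_ne : c ≠ n

/-- There is an arrow of the quiver from `v` to `w`. With `(n,0,0)` at the bottom left, `(0,n,0)` at
the top and `(0,0,n)` at the bottom right, the small upward triangles are oriented
counterclockwise and the small downward ones clockwise. -/
def Arrow {n : ℕ} (v w : Vertex n) : Prop :=
  (w.a + 1 = v.a ∧ w.b = v.b ∧ w.c = v.c + 1) ∨
  (w.a = v.a ∧ w.b = v.b + 1 ∧ w.c + 1 = v.c) ∨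
  (w.a = v.a + 1 ∧ w.b + 1 = v.b ∧ w.c = v.c)

/-- Both vertices lie on one side of the big triangle; arrows between such vertices are dotted. -/
def SameSide {n : ℕ} (v w : Vertex n) : Prop :=
  (v.a = 0 ∧ w.a = 0) ∨ (v.b = 0 ∧ w.b = 0) ∨ (v.c = 0 ∧ w.c = 0)

open Classical in
/-- The Poisson matrix: solid arrows have weight `2`, dotted arrows weight `1`. -/
def poisson (n : ℕ) (v w : Vertex n) : ℤ :=
  if Arrow v w then (if SameSide v w then 1 else 2)
  else if Arrow w v then (if SameSide v w then -1 else -2)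
  else 0

theorem poisson_antisymm (n : ℕ) (v w : Vertex n) : poisson n v w = -poisson n w v := by
  unfold poisson Arrow SameSide
  split_ifs <;> omega

/-- The Fock–Goncharov quantum torus of the discrete `n`-triangle. -/
abbrev FGTorus (n : ℕ) (ω : ℂ) : Type := QTorus (poisson n) ω

/-! ### Classical matrices over a commutative algebra

The argument `x` is the chosen (invertible) `n`-th root `X^{1/n}` of the coordinate `X = x ^ n`.
Rows and columns are indexed by `Fin n`, that is, shifted by one: `i : Fin n` is the row `i + 1`. -/

/-- The `k`-th left-shearing matrix
`X^{-(k-1)/n} (diag(X, …, X, 1, …, 1) + E_{k,k+1})` with `X` appearing `k - 1` times. -/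
def leftShear {A : Type} [CommRing A] (n k : ℕ) (x : Aˣ) : Matrix (Fin n) (Fin n) A :=
  ((x ^ (-((k : ℤ) - 1)) : Aˣ) : A) • Matrix.of fun (i j : Fin n) =>
    if i = j then (if (i : ℕ) + 1 < k then (x : A) ^ n else 1)
    else if (i : ℕ) + 1 = k ∧ (j : ℕ) = k then 1 else 0

/-- The `k`-th right-shearing matrix
`X^{(k-1)/n} (diag(1, …, 1, X⁻¹, …, X⁻¹) + E_{n-k+1,n-k})` with `X⁻¹` appearing `k - 1` times. -/
def rightShear {A : Type} [CommRing A] (n k : ℕ) (x : Aˣ) : Matrix (Fin n) (Fin n) A :=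
  ((x ^ ((k : ℤ) - 1) : Aˣ) : A) • Matrix.of fun (i j : Fin n) =>
    if i = j then (if n < (i : ℕ) + k then ((x⁻¹ : Aˣ) : A) ^ n else 1)
    else if (i : ℕ) + k = n ∧ (j : ℕ) + 1 = i then 1 else 0

/-- The `k`-th edge-shearing matrix `Z^{-k/n} diag(Z, …, Z, 1, …, 1)` with `Z` appearing `k`
times. -/
def edgeShear {A : Type} [CommRing A] (n k : ℕ) (z : Aˣ) : Matrix (Fin n) (Fin n) A :=
  ((z ^ (-(k : ℤ)) : Aˣ) : A) • Matrix.diagonal fun i : Fin n =>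
    if (i : ℕ) < k then (z : A) ^ n else 1

/-- The left matrix: the product over `k = n-1, …, 1`, from left to right, of
`S₁ S₂(X_{1,n-k,k-1}) ⋯ S_k(X_{k-1,n-k,1})`. The first factor does not depend on its argument. -/
def leftMatrix {A : Type} [CommRing A] (n : ℕ) (x : ℕ → ℕ → ℕ → Aˣ) : Matrix (Fin n) (Fin n) A :=
  ((List.Ico 1 n).reverse.map fun k =>
    leftShear n 1 1 *
      ((List.Ico 2 (k + 1)).map fun l => leftShear n l (x (l - 1) (n - k) (k + 1 - l))).prod).prod

/-- The right matrix: the product over `k = n-1, …, 1`, from left to right, of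
`S₁ S₂(X_{k-1,n-k,1}) ⋯ S_k(X_{1,n-k,k-1})`. The first factor does not depend on its argument. -/
def rightMatrix {A : Type} [CommRing A] (n : ℕ) (x : ℕ → ℕ → ℕ → Aˣ) : Matrix (Fin n) (Fin n) A :=
  ((List.Ico 1 n).reverse.map fun k =>
    rightShear n 1 1 *
      ((List.Ico 2 (k + 1)).map fun l => rightShear n l (x (k + 1 - l) (n - k) (l - 1))).prod).prod

/-- The edge matrix `S₁(Z₁) ⋯ S_{n-1}(Z_{n-1})`. -/
def edgeMatrix {A : Type} [CommRing A] (n : ℕ) (z : ℕ → Aˣ) : Matrix (Fin n) (Fin n) A :=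
  ((List.Ico 1 n).map fun l => edgeShear n l (z l)).prod

/-! ### Quantum left and right matrices -/

/-- The generator `X_v^{1/n}` of the Laurent polynomial algebra, as a unit. -/
def coordUnit {V : Type} (v : V) : (Laurent V)ˣ where
  val := AddMonoidAlgebra.single (Finsupp.single v 1) 1
  inv := AddMonoidAlgebra.single (Finsupp.single v (-1)) 1
  val_inv := by
    rw [AddMonoidAlgebra.single_mul_single, ← Finsupp.single_add]
    simp [AddMonoidAlgebra.one_def]
  inv_val := by
    rw [AddMonoidAlgebra.single_mul_single, ← Finsupp.single_add]
    simp [AddMonoidAlgebra.one_def]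

open Classical in
/-- The generator `X_{abc}^{1/n}`. It is only used at vertices `(a, b, c)`; the value `1` elsewhere
is a placeholder. -/
def coord (n a b c : ℕ) : (Laurent (Vertex n))ˣ :=
  if h : a + b + c = n ∧ a ≠ n ∧ b ≠ n ∧ c ≠ n then
    coordUnit ⟨a, b, c, h.1, h.2.1, h.2.2.1, h.2.2.2⟩
  else 1

/-- The quantum left matrix `[M^edge(Z) M^left(X) M^edge(Z')]`, where `Z_j = X_{j,0,n-j}` and
`Z'_j = X_{j,n-j,0}`. -/
def quantumLeft (n : ℕ) (ω η : ℂ) : Matrix (Fin n) (Fin n) (FGTorus n ω) :=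
  (edgeMatrix n (fun j => coord n j 0 (n - j)) * leftMatrix n (coord n) *
    edgeMatrix n (fun j => coord n j (n - j) 0)).map (weyl (poisson n) ω η)

/-- The quantum right matrix `[M^edge(Z) M^right(X) M^edge(Z'')]`, where `Z_j = X_{j,0,n-j}` and
`Z''_j = X_{0,j,n-j}`. -/
def quantumRight (n : ℕ) (ω η : ℂ) : Matrix (Fin n) (Fin n) (FGTorus n ω) :=
  (edgeMatrix n (fun j => coord n j 0 (n - j)) * rightMatrix n (coord n) *
    edgeMatrix n (fun j => coord n 0 j (n - j))).map (weyl (poisson n) ω η)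

/-! ### The quantum special linear group and its points -/

/-- The `2 × 2` matrix with rows `(a, b)` and `(c, d)` is a point of the quantum matrix algebra
`M_2^q`. -/
def IsM2Point {T : Type} [Ring T] [Algebra ℂ T] (q : ℂ) (a b c d : T) : Prop :=
  b * a = q • (a * b) ∧ d * c = q • (c * d) ∧ c * a = q • (a * c) ∧ d * b = q • (b * d) ∧
    b * c = c * b ∧ d * a - a * d = (q - q⁻¹) • (b * c)

/-- Every `2 × 2` submatrix is a point of `M_2^q`. -/
def IsMPoint {T : Type} [Ring T] [Algebra ℂ T] {n : ℕ} (q : ℂ) (M : Matrix (Fin n) (Fin n) T) :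
    Prop :=
  ∀ i j k m : Fin n, i < j → k < m → IsM2Point q (M i k) (M i m) (M j k) (M j m)

/-- The number of inversions (the length) of a permutation. -/
def inversions {n : ℕ} (σ : Equiv.Perm (Fin n)) : ℕ :=
  (Finset.univ.filter fun p : Fin n × Fin n => p.1 < p.2 ∧ σ p.2 < σ p.1).card

/-- The quantum determinant `∑_σ (-q⁻¹)^{ℓ(σ)} M_{1σ(1)} ⋯ M_{nσ(n)}`; for `n = 2` it is
`ad - q⁻¹ bc`. -/
def qdet {T : Type} [Ring T] [Algebra ℂ T] {n : ℕ} (q : ℂ) (M : Matrix (Fin n) (Fin n) T) : T :=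
  ∑ σ : Equiv.Perm (Fin n), (-q⁻¹) ^ inversions σ • (List.ofFn fun i => M i (σ i)).prod

/-- `M` is a `T`-point of the quantum special linear group `SL_n^q`. -/
def IsSLPoint {T : Type} [Ring T] [Algebra ℂ T] {n : ℕ} (q : ℂ) (M : Matrix (Fin n) (Fin n) T) :
    Prop :=
  IsMPoint q M ∧ qdet q M = 1

/-- The matrix of the free generators of the free algebra on `n²` letters. -/
def freeMatrix (n : ℕ) : Matrix (Fin n) (Fin n) (FreeAlgebra ℂ (Fin n × Fin n)) :=
  Matrix.of fun i j => FreeAlgebra.ι ℂ (i, j)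

/-- The defining relations of the algebra `SL_n^q`. -/
inductive SLRel (n : ℕ) (q : ℂ) :
    FreeAlgebra ℂ (Fin n × Fin n) → FreeAlgebra ℂ (Fin n × Fin n) → Prop
  | row₁ (i j k m : Fin n) (hij : i < j) (hkm : k < m) :
      SLRel n q (freeMatrix n i m * freeMatrix n i k) (q • (freeMatrix n i k * freeMatrix n i m))
  | row₂ (i j k m : Fin n) (hij : i < j) (hkm : k < m) :
      SLRel n q (freeMatrix n j m * freeMatrix n j k) (q • (freeMatrix n j k * freeMatrix n j m))
  | col₁ (i j k m : Fin n) (hij : i < j) (hkm : k < m) :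
      SLRel n q (freeMatrix n j k * freeMatrix n i k) (q • (freeMatrix n i k * freeMatrix n j k))
  | col₂ (i j k m : Fin n) (hij : i < j) (hkm : k < m) :
      SLRel n q (freeMatrix n j m * freeMatrix n i m) (q • (freeMatrix n i m * freeMatrix n j m))
  | anti (i j k m : Fin n) (hij : i < j) (hkm : k < m) :
      SLRel n q (freeMatrix n i m * freeMatrix n j k) (freeMatrix n j k * freeMatrix n i m)
  | diag (i j k m : Fin n) (hij : i < j) (hkm : k < m) :
      SLRel n q (freeMatrix n j m * freeMatrix n i k - freeMatrix n i k * freeMatrix n j m)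
        ((q - q⁻¹) • (freeMatrix n i m * freeMatrix n j k))
  | det : SLRel n q (qdet q (freeMatrix n)) 1

/-- The algebra `SL_n^q`. -/
abbrev SLq (n : ℕ) (q : ℂ) : Type := RingQuot (SLRel n q)

/-- The `n²` generators of `SL_n^q`. -/
def SLq.gen (n : ℕ) (q : ℂ) (i j : Fin n) : SLq n q :=
  RingQuot.mkAlgHom ℂ (SLRel n q) (freeMatrix n i j)

end FockGoncharov

end

noncomputable section

namespace FockGoncharov

/-! ### Multiplicativity of the Weyl ordering -/

section WeylOrdering

variable {V : Type} (P : V → V → ℤ) (ω η : ℂ)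

/-! The classical matrix is a product of diagonal matrices and elementary matrices `1 + E_{k,k+1}`,
but coordinates in different factors need not commute in the quantum torus, so Weyl ordering cannot
be applied factor by factor. A change of variables removes the obstruction. Take monomials `u_{ab}`,
`y_{ab}` (`a, b ≥ 1`, `a + b ≤ n`) forming canonical pairs, independent of each other, and central
monomials `g_{ab}`. Writing the coordinate at `(a, b, n - a - b)`, `a ≥ 1`, as `y_{ab}⁻¹ u_{a+1,b}⁻¹
g_{ab} y_{a,b+1} u_{a,b+1}² u_{a-1,b+1}⁻¹` reproduces the quiver weights (`poisson_leftVertex`) and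
splits the left matrix into central diagonal matrices and factors that each involve a single
canonical pair (`left_eq_prod_elementary`).

Such a factor is the identity except for a block with rows `(U, YU)` and `(0, U⁻¹)`, where `U = uⁿ`
and `Y = yⁿ`. Its ordering is a triangular point of `SL_n^q` because `η ^ (2 n²) = q`
(`isTwistedPoint_bidiagonal`). Distinct factors have orthogonal exponents. Hence ordering is
multiplicative across them and their entries commute, and products of quantum matrices with mutually
commuting entries are quantum by the RTT relation (`IsQuantumMatrix.mul`). Triangularity reduces the
quantum determinant to the product of the diagonal.

All this happens in a twisted group algebra of the parameter lattice, whereas the torus is given by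
generators and relations. No basis of the torus is needed: the twisted algebra acts on its own
underlying space, and a linear map from that space to the torus intertwines the action with left
multiplication on the relevant vectors (`IsBorelPoint.transfer`). The `g_{ab}` make this map
possible, since they record the exponent of each coordinate.

The right matrix is the left matrix with rows and columns reversed, coordinates inverted and the
triangle reflected. Reflection negates the Poisson matrix, so the argument runs with `η⁻¹` and
`q⁻¹`, and the reversal turns `q⁻¹` back into `q`. -/

theorem QTorus.X_zero (v : V) : QTorus.X P ω v 0 = 1 := by
  simp only [QTorus.X]
  rw [show freePow v 0 = 1 from pow_zero _, map_one]

theorem QTorus.X_mul_X_neg (v : V) (r : ℤ) : QTorus.X P ω v r * QTorus.X P ω v (-r) = 1 := by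
  have h := RingQuot.mkAlgHom_rel ℂ (TorusRel.inv (P := P) (ω := ω) v r)
  simpa [QTorus.X] using h

/-- The generator `X_v^{1/n}` as a unit of the quantum torus. -/
def QTorus.unit (v : V) : (QTorus P ω)ˣ where
  val := QTorus.X P ω v 1
  inv := QTorus.X P ω v (-1)
  val_inv := QTorus.X_mul_X_neg P ω v 1
  inv_val := by simpa using QTorus.X_mul_X_neg P ω v (-1)

/-- Positive and negative powers are words in two different letters; the relations make these
letters mutually inverse. Additivity in the exponent, which is not among the relations, follows from
this. -/
theorem QTorus.X_eq_unit_zpow (v : V) (r : ℤ) :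
    QTorus.X P ω v r = ((QTorus.unit P ω v ^ r : (QTorus P ω)ˣ) : QTorus P ω) := by
  have h₁ : QTorus.X P ω v 1 = RingQuot.mkAlgHom ℂ (TorusRel P ω) (FreeAlgebra.ι ℂ (v, true)) := by
    simp only [QTorus.X]
    rw [show freePow v 1 = FreeAlgebra.ι ℂ (v, true) from pow_one _]
  have h₂ : QTorus.X P ω v (-1) =
      RingQuot.mkAlgHom ℂ (TorusRel P ω) (FreeAlgebra.ι ℂ (v, false)) := by
    simp only [QTorus.X]
    rw [show freePow v (-1) = FreeAlgebra.ι ℂ (v, false) from pow_one _]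
  cases r with
  | ofNat m =>
    rw [Int.ofNat_eq_natCast, zpow_natCast, Units.val_pow_eq_pow_val]
    change _ = QTorus.X P ω v 1 ^ m
    rw [h₁, ← map_pow]
    rfl
  | negSucc m =>
    rw [zpow_negSucc, ← inv_pow, Units.val_pow_eq_pow_val]
    change _ = QTorus.X P ω v (-1) ^ (m + 1)
    rw [h₂, ← map_pow]
    rfl

theorem QTorus.X_add (v : V) (r s : ℤ) :
    QTorus.X P ω v (r + s) = QTorus.X P ω v r * QTorus.X P ω v s := by
  simp only [QTorus.X_eq_unit_zpow, zpow_add, Units.val_mul]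

/-- The bilinear form on exponents defined by the Poisson matrix. -/
def exponentForm : (V →₀ ℤ) →ₗ[ℤ] (V →₀ ℤ) →ₗ[ℤ] ℤ :=
  Finsupp.linearCombination ℤ fun v => Finsupp.linearCombination ℤ fun w => P v w

theorem exponentForm_single (v w : V) (r s : ℤ) :
    exponentForm P (Finsupp.single v r) (Finsupp.single w s) = P v w * r * s := by
  simp [exponentForm]
  ring

/-- The exponent of the monomial represented by a word. -/
def wordExponent (l : List (V × ℤ)) : V →₀ ℤ := (l.map fun x => Finsupp.single x.1 x.2).sum

theorem wordExponent_cons (x : V × ℤ) (l : List (V × ℤ)) :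
    wordExponent (x :: l) = Finsupp.single x.1 x.2 + wordExponent l := by
  simp [wordExponent]

theorem sum_map_eq_exponentForm (x : V × ℤ) (l : List (V × ℤ)) :
    (l.map fun y => P x.1 y.1 * x.2 * y.2).sum =
      exponentForm P (Finsupp.single x.1 x.2) (wordExponent l) := by
  induction l with
  | nil => simp [wordExponent]
  | cons y l ih =>
    rw [List.map_cons, List.sum_cons, ih, wordExponent_cons, map_add, exponentForm_single]

/-- The canonical word representing a monomial. -/
def canonicalWord (m : V →₀ ℤ) : List (V × ℤ) := m.support.toList.map fun v => (v, m v)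

theorem wordExponent_canonicalWord (m : V →₀ ℤ) : wordExponent (canonicalWord m) = m := by
  simp only [wordExponent, canonicalWord, List.map_map, Function.comp_def]
  rw [Finset.sum_map_toList]
  exact m.sum_single

theorem weylWord_cons (hη : η ≠ 0) (x : V × ℤ) (l : List (V × ℤ)) :
    weylWord P ω η (x :: l) =
      η ^ (-exponentForm P (Finsupp.single x.1 x.2) (wordExponent l)) •
        (QTorus.X P ω x.1 x.2 * weylWord P ω η l) := by
  simp only [weylWord, weylExponent, List.map_cons, List.prod_cons]
  rw [sum_map_eq_exponentForm, neg_add, zpow_add₀ hη, mul_smul, mul_smul_comm]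

/-- The exponents of the two sides differ by the pairs with one letter in each word, which add up to
the bilinear form. -/
theorem weylWord_append (hη : η ≠ 0) (l l' : List (V × ℤ)) :
    weylWord P ω η l * weylWord P ω η l' =
      η ^ exponentForm P (wordExponent l) (wordExponent l') • weylWord P ω η (l ++ l') := by
  induction l with
  | nil => simp [weylWord, weylExponent, wordExponent]
  | cons x l ih =>
    rw [List.cons_append, weylWord_cons P ω η hη, weylWord_cons P ω η hη, smul_mul_assoc,
      mul_assoc, ih, mul_smul_comm, smul_smul, smul_smul, ← zpow_add₀ hη, ← zpow_add₀ hη]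
    congr 2
    have : wordExponent (l ++ l') = wordExponent l + wordExponent l' := by simp [wordExponent]
    rw [this, wordExponent_cons]
    simp only [map_add, LinearMap.add_apply]
    ring

variable {P}

theorem weylWord_cons_zero (hη : η ≠ 0) (v : V) (l : List (V × ℤ)) :
    weylWord P ω η ((v, 0) :: l) = weylWord P ω η l := by
  rw [weylWord_cons P ω η hη]
  simp [QTorus.X_zero]

theorem weylWord_merge (hP : ∀ v w, P v w = -P w v) (hη : η ≠ 0) (v : V) (r s : ℤ)
    (l : List (V × ℤ)) :
    weylWord P ω η ((v, r) :: (v, s) :: l) = weylWord P ω η ((v, r + s) :: l) := by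
  have h0 : P v v = 0 := by have := hP v v; omega
  rw [weylWord_cons P ω η hη, weylWord_cons P ω η hη, weylWord_cons P ω η hη, QTorus.X_add,
    mul_smul_comm, smul_smul, ← zpow_add₀ hη, mul_assoc]
  congr 2
  simp only [wordExponent_cons, map_add, exponentForm_single, Finsupp.single_add,
    LinearMap.add_apply, h0]
  ring

theorem canonicalWord_perm_cons_erase (m : V →₀ ℤ) {v : V} (hv : v ∈ m.support) :
    (canonicalWord m).Perm ((v, m v) :: canonicalWord (m.erase v)) := by
  classical
  have h₁ : m.support.toList.Perm (v :: (m.erase v).support.toList) := by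
    rw [Finsupp.support_erase]
    refine List.perm_of_nodup_nodup_toFinset_eq (Finset.nodup_toList _) ?_ ?_
    · simp [Finset.nodup_toList]
    · simp [Finset.insert_erase hv]
  refine (h₁.map fun w => (w, m w)).trans ?_
  rw [List.map_cons, canonicalWord]
  refine List.Perm.cons _ (List.Perm.of_eq (List.map_congr_left fun w hw => ?_))
  have : w ≠ v := by
    rintro rfl
    simp at hw
  rw [Finsupp.erase_ne this]

theorem weylWord_canonicalWord_erase (hP : ∀ v w, P v w = -P w v) (hη : η ≠ 0) (hω : η ^ 2 = ω)
    (m : V →₀ ℤ) (v : V) :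
    weylWord P ω η (canonicalWord m) =
      weylWord P ω η ((v, m v) :: canonicalWord (m.erase v)) := by
  by_cases hv : v ∈ m.support
  · exact weylWord_perm P hP ω η hη hω (canonicalWord_perm_cons_erase m hv)
  · rw [Finsupp.notMem_support_iff.1 hv, weylWord_cons_zero ω η hη,
      Finsupp.erase_of_notMem_support hv]

/-- The letter `v` is extracted from the canonical word, possibly with exponent zero, merged and put
back. Allowing exponent zero covers the cases where `v` enters or leaves the support. -/
theorem weylWord_cons_canonicalWord (hP : ∀ v w, P v w = -P w v) (hη : η ≠ 0) (hω : η ^ 2 = ω)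
    (m : V →₀ ℤ) (v : V) (r : ℤ) :
    weylWord P ω η ((v, r) :: canonicalWord m) =
      weylWord P ω η (canonicalWord (Finsupp.single v r + m)) := by
  have h₁ : weylWord P ω η ((v, r) :: canonicalWord m) =
      weylWord P ω η ((v, r) :: (v, m v) :: canonicalWord (m.erase v)) := by
    rw [weylWord_cons P ω η hη, weylWord_cons P ω η hη (v, r),
      weylWord_canonicalWord_erase ω η hP hη hω m v, wordExponent_canonicalWord, wordExponent_cons,
      wordExponent_canonicalWord, Finsupp.single_add_erase]
  rw [h₁, weylWord_merge ω η hP hη, weylWord_canonicalWord_erase ω η hP hη hω _ v,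
    Finsupp.erase_add, Finsupp.erase_single, zero_add, Finsupp.add_apply, Finsupp.single_eq_same]

/-- The Weyl ordering of a word only depends on the monomial it represents. -/
theorem weylWord_eq_canonicalWord (hP : ∀ v w, P v w = -P w v) (hη : η ≠ 0) (hω : η ^ 2 = ω)
    (l : List (V × ℤ)) :
    weylWord P ω η l = weylWord P ω η (canonicalWord (wordExponent l)) := by
  induction l with
  | nil => simp [wordExponent, canonicalWord]
  | cons x l ih =>
    rw [wordExponent_cons, ← weylWord_cons_canonicalWord ω η hP hη hω, weylWord_cons P ω η hη,
      weylWord_cons P ω η hη, ih, wordExponent_canonicalWord]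

theorem weyl_single (m : V →₀ ℤ) (c : ℂ) :
    weyl P ω η (AddMonoidAlgebra.single m c) = c • weylWord P ω η (canonicalWord m) := by
  simp [weyl, canonicalWord]

/-- Weyl-ordered monomials multiply as in the group algebra twisted by the exponent form. Together
with the value at exponent zero, this is all that the transfer below uses about the torus. -/
theorem weylWord_canonicalWord_mul (hP : ∀ v w, P v w = -P w v) (hη : η ≠ 0) (hω : η ^ 2 = ω)
    (m m' : V →₀ ℤ) :
    weylWord P ω η (canonicalWord m) * weylWord P ω η (canonicalWord m') =
      η ^ exponentForm P m m' • weylWord P ω η (canonicalWord (m + m')) := by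
  rw [weylWord_append P ω η hη, weylWord_eq_canonicalWord ω η hP hη hω (_ ++ _)]
  have : wordExponent (canonicalWord m ++ canonicalWord m') = m + m' := by
    conv_rhs => rw [← wordExponent_canonicalWord m, ← wordExponent_canonicalWord m']
    simp [wordExponent]
  rw [this, wordExponent_canonicalWord, wordExponent_canonicalWord]

theorem weylWord_canonicalWord_zero :
    weylWord P ω η (canonicalWord (0 : V →₀ ℤ)) = 1 := by
  simp [weylWord, canonicalWord, weylExponent]

end WeylOrdering

/-! ### Quantum matrices and the `R`-matrix -/

section QuantumMatrices

variable {T : Type} [Ring T] {n : ℕ}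

/-- The matrix `M ⊗ M` with entries `M i k * M j l`. -/
def tensorSquare (M : Matrix (Fin n) (Fin n) T) : Matrix (Fin n × Fin n) (Fin n × Fin n) T :=
  Matrix.of fun x y => M x.1 y.1 * M x.2 y.2

theorem tensorSquare_mul {M N : Matrix (Fin n) (Fin n) T}
    (h : ∀ i j k l, Commute (M i j) (N k l)) :
    tensorSquare (M * N) = tensorSquare M * tensorSquare N := by
  ext ⟨i, j⟩ ⟨k, l⟩
  simp only [tensorSquare, Matrix.of_apply, Matrix.mul_apply, Fintype.sum_prod_type,
    Finset.sum_mul_sum]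
  refine Finset.sum_congr rfl fun s _ => Finset.sum_congr rfl fun t _ => ?_
  rw [mul_assoc, mul_assoc, ← mul_assoc (N s k), ← (h j t s k).eq, mul_assoc]

variable [Algebra ℂ T] {q : ℂ}

/-- The relations of the algebra of quantum matrices, for the entries of `M`. -/
structure IsQuantumMatrix (q : ℂ) (M : Matrix (Fin n) (Fin n) T) : Prop where
  row : ∀ i k m, k < m → M i m * M i k = q • (M i k * M i m)
  col : ∀ i j k, i < j → M j k * M i k = q • (M i k * M j k)
  anti : ∀ i j k m, i < j → k < m → M i m * M j k = M j k * M i m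
  diag : ∀ i j k m, i < j → k < m →
    M j m * M i k - M i k * M j m = (q - q⁻¹) • (M i m * M j k)

theorem IsQuantumMatrix.isMPoint {M : Matrix (Fin n) (Fin n) T} (h : IsQuantumMatrix q M) :
    IsMPoint q M := fun i j k m hij hkm =>
  ⟨h.row i k m hkm, h.row j k m hkm, h.col i j k hij, h.col i j m hij, h.anti i j k m hij hkm,
    h.diag i j k m hij hkm⟩

/-- Reversing both index orders swaps the two entries in each row, column and diagonal relation,
which inverts `q`. -/
theorem IsQuantumMatrix.reverse {M : Matrix (Fin n) (Fin n) T} (hq : q ≠ 0)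
    (h : IsQuantumMatrix q⁻¹ M) : IsQuantumMatrix q (M.submatrix Fin.rev Fin.rev) where
  row i k m hkm := by
    have := h.row i.rev m.rev k.rev (by simpa using hkm)
    simp only [Matrix.submatrix_apply, this, smul_smul, mul_inv_cancel₀ hq, one_smul]
  col i j k hij := by
    have := h.col j.rev i.rev k.rev (by simpa using hij)
    simp only [Matrix.submatrix_apply, this, smul_smul, mul_inv_cancel₀ hq, one_smul]
  anti i j k m hij hkm := by
    have := h.anti j.rev i.rev m.rev k.rev (by simpa using hij) (by simpa using hkm)
    simp only [Matrix.submatrix_apply, this]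
  diag i j k m hij hkm := by
    have h₁ := h.diag j.rev i.rev m.rev k.rev (by simpa using hij) (by simpa using hkm)
    have h₂ := h.anti j.rev i.rev m.rev k.rev (by simpa using hij) (by simpa using hkm)
    rw [h₂, inv_inv] at h₁
    simp only [Matrix.submatrix_apply]
    rw [← neg_sub, h₁, ← neg_smul, neg_sub]

/-- The diagonal coefficient of the braided `R`-matrix at `e_i ⊗ e_j`. -/
def braidCoeff (q : ℂ) (i j : Fin n) : ℂ := if i = j then q else if j < i then q - q⁻¹ else 0

/-- The braided `R`-matrix of `GL_n`, with entries in `T`. -/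
def braidMatrix (T : Type) [Ring T] [Algebra ℂ T] (n : ℕ) (q : ℂ) :
    Matrix (Fin n × Fin n) (Fin n × Fin n) T := Matrix.of fun x y =>
  (if x = y then algebraMap ℂ T (braidCoeff q x.1 x.2) else 0) +
    (if x.1 ≠ x.2 ∧ y = x.swap then 1 else 0)

theorem braidMatrix_mul_apply (M : Matrix (Fin n) (Fin n) T) (i j k l : Fin n) :
    (braidMatrix T n q * tensorSquare M) (i, j) (k, l) =
      braidCoeff q i j • (M i k * M j l) + if i ≠ j then M j k * M i l else 0 := by
  rw [Matrix.mul_apply]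
  simp only [braidMatrix, tensorSquare, Matrix.of_apply, add_mul, Finset.sum_add_distrib, ite_mul,
    zero_mul, one_mul, Finset.sum_ite_eq, Finset.mem_univ, if_true, Algebra.smul_def]
  congr 1
  by_cases h : i = j
  · simp [h]
  · simp [h]

theorem mul_braidMatrix_apply (M : Matrix (Fin n) (Fin n) T) (i j k l : Fin n) :
    (tensorSquare M * braidMatrix T n q) (i, j) (k, l) =
      braidCoeff q k l • (M i k * M j l) + if k ≠ l then M i l * M j k else 0 := by
  rw [Matrix.mul_apply]
  simp only [braidMatrix, tensorSquare, Matrix.of_apply, mul_add, Finset.sum_add_distrib, mul_ite,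
    mul_zero, mul_one, Finset.sum_ite_eq', Finset.mem_univ, if_true]
  congr 1
  · rw [← Algebra.commutes, Algebra.smul_def]
  · rw [Finset.sum_eq_single (l, k)]
    · simp [eq_comm]
    · rintro ⟨s, t⟩ - hst
      rw [if_neg]
      rintro ⟨-, h⟩
      simp only [Prod.swap_prod_mk, Prod.mk.injEq] at h
      exact hst (by rw [h.1, h.2])
    · simp

/-- The relations of quantum matrices are equivalent to the `RTT` relation. -/
theorem isQuantumMatrix_iff (hq : q ≠ 0) (M : Matrix (Fin n) (Fin n) T) :
    IsQuantumMatrix q M ↔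
      braidMatrix T n q * tensorSquare M = tensorSquare M * braidMatrix T n q := by
  constructor
  · intro h
    ext ⟨i, j⟩ ⟨k, l⟩
    rw [braidMatrix_mul_apply, mul_braidMatrix_apply]
    rcases lt_trichotomy i j with hij | rfl | hij <;> rcases lt_trichotomy k l with hkl | rfl | hkl
    · simp [braidCoeff, hij.ne, hkl.ne, hij.not_gt, hkl.not_gt, h.anti i j k l hij hkl]
    · simp [braidCoeff, hij.ne, hij.not_gt, h.col i j k hij]
    · simp only [braidCoeff, hij.ne, hkl.ne', hij.not_gt, hkl, if_false, if_true, zero_smul,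
        zero_add, ne_eq, not_false_eq_true, ← h.diag i j l k hij hkl, sub_add_cancel]
    · simp only [braidCoeff, hkl.ne, hkl.not_gt, if_false, if_true, zero_smul,
        zero_add, ne_eq, not_false_eq_true, h.row i k l hkl, not_true, add_zero]
    · simp [braidCoeff]
    · simp only [braidCoeff, hkl.ne', hkl, if_false, if_true,
        ne_eq, not_false_eq_true, h.row i l k hkl, not_true, add_zero, smul_smul, sub_mul,
        inv_mul_cancel₀ hq, sub_smul, one_smul, sub_add_cancel]
    · simp only [braidCoeff, hij.ne', hkl.ne, hkl.not_gt, hij, if_false, if_true, zero_smul,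
        zero_add, ne_eq, not_false_eq_true, ← h.anti j i k l hij hkl, ← h.diag j i k l hij hkl,
        sub_add_cancel]
    · simp only [braidCoeff, hij.ne', hij, if_false, if_true,
        ne_eq, not_false_eq_true, h.col j i k hij, not_true, add_zero, smul_smul, sub_mul,
        inv_mul_cancel₀ hq, sub_smul, one_smul, sub_add_cancel]
    · simp only [braidCoeff, hij.ne', hkl.ne', hij, hkl, if_false, if_true, ne_eq,
        not_false_eq_true, h.anti j i l k hij hkl]
  · intro h
    have key : ∀ i j k l : Fin n, _ := fun i j k l => congrFun (congrFun h (i, j)) (k, l)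
    simp only [braidMatrix_mul_apply, mul_braidMatrix_apply] at key
    refine ⟨fun i k m hkm => ?_, fun i j k hij => ?_, fun i j k m hij hkm => ?_,
      fun i j k m hij hkm => ?_⟩
    · simpa [braidCoeff, hkm.ne, hkm.not_gt] using (key i i k m).symm
    · simpa [braidCoeff, hij.ne, hij.not_gt] using key i j k k
    · simpa [braidCoeff, hij.ne, hij.not_gt, hkm.ne, hkm.not_gt] using (key i j k m).symm
    · have := key i j m k
      simp only [braidCoeff, hij.ne, hkm.ne', hij.not_gt, hkm, if_false, if_true, zero_smul,
        zero_add, ne_eq, not_false_eq_true] at this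
      rw [this, add_sub_cancel_right]

/-- In RTT form the relations say that `M ⊗ M` commutes with a fixed scalar matrix, and `M ↦ M ⊗ M`
is multiplicative when the entries of the two factors commute. -/
theorem IsQuantumMatrix.mul {M N : Matrix (Fin n) (Fin n) T} (hq : q ≠ 0)
    (hM : IsQuantumMatrix q M) (hN : IsQuantumMatrix q N)
    (h : ∀ i j k l, Commute (M i j) (N k l)) : IsQuantumMatrix q (M * N) := by
  rw [isQuantumMatrix_iff hq] at hM hN ⊢
  rw [tensorSquare_mul h, ← Matrix.mul_assoc, hM, Matrix.mul_assoc, hN, Matrix.mul_assoc]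

/-! ### Quantum determinants of triangular matrices -/

/-- A quantum matrix that is upper triangular, with diagonal entries of product one. -/
structure IsBorelPoint (q : ℂ) (M : Matrix (Fin n) (Fin n) T) : Prop where
  quantum : IsQuantumMatrix q M
  upper : ∀ i j, j < i → M i j = 0
  prod_diag : (List.ofFn fun i => M i i).prod = 1

theorem list_prod_map_mul_of_commute {M ι : Type*} [Monoid M] (f g : ι → M)
    (h : ∀ i j, Commute (f i) (g j)) (l : List ι) :
    (l.map fun i => f i * g i).prod = (l.map f).prod * (l.map g).prod := by
  induction l with
  | nil => simp
  | cons a l ih =>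
    have : Commute (g a) (l.map f).prod :=
      Commute.list_prod_right _ _ fun x hx => by
        obtain ⟨i, -, rfl⟩ := List.mem_map.1 hx
        exact (h i a).symm
    simp only [List.map_cons, List.prod_cons, ih]
    rw [mul_assoc, ← mul_assoc (g a), this.eq]
    simp only [mul_assoc]

theorem mul_diag_of_upper {R : Type*} [Semiring R] {M N : Matrix (Fin n) (Fin n) R}
    (hM : ∀ i j, j < i → M i j = 0) (hN : ∀ i j, j < i → N i j = 0) (i : Fin n) :
    (M * N) i i = M i i * N i i := by
  rw [Matrix.mul_apply, Finset.sum_eq_single i]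
  · intro j _ hj
    rcases lt_or_gt_of_ne hj with h | h
    · rw [hM i j h, zero_mul]
    · rw [hN j i h, mul_zero]
  · simp

theorem IsBorelPoint.mul {M N : Matrix (Fin n) (Fin n) T} (hq : q ≠ 0)
    (hM : IsBorelPoint q M) (hN : IsBorelPoint q N)
    (h : ∀ i j k l, Commute (M i j) (N k l)) : IsBorelPoint q (M * N) where
  quantum := hM.quantum.mul hq hN.quantum h
  upper i j hij := by
    rw [Matrix.mul_apply]
    refine Finset.sum_eq_zero fun k _ => ?_
    rcases lt_or_ge k i with hk | hk
    · rw [hM.upper i k hk, zero_mul]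
    · rw [hN.upper k j (hij.trans_le hk), mul_zero]
  prod_diag := by
    have h₁ := hM.prod_diag
    have h₂ := hN.prod_diag
    simp only [mul_diag_of_upper hM.upper hN.upper, List.ofFn_eq_map] at h₁ h₂ ⊢
    rw [list_prod_map_mul_of_commute _ _ fun i j => h i i j j, h₁, h₂, one_mul]

/-- In the diagonal relation for rows and columns `i < j` the right side contains the vanishing
entry below the diagonal. -/
theorem IsBorelPoint.commute_diag {M : Matrix (Fin n) (Fin n) T} (hM : IsBorelPoint q M)
    (i j : Fin n) : Commute (M i i) (M j j) := by
  have key : ∀ i j : Fin n, i < j → Commute (M i i) (M j j) := fun i j hij => by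
    have := hM.quantum.diag i j i j hij hij
    rw [hM.upper j i hij, mul_zero, smul_zero, sub_eq_zero] at this
    exact this.symm
  rcases lt_trichotomy i j with h | rfl | h
  · exact key i j h
  · exact Commute.refl _
  · exact (key j i h).symm

theorem qdet_of_support_one {M : Matrix (Fin n) (Fin n) T}
    (h : ∀ σ : Equiv.Perm (Fin n), σ ≠ 1 → ∃ i, M i (σ i) = 0) :
    qdet q M = (List.ofFn fun i => M i i).prod := by
  rw [qdet, Finset.sum_eq_single 1]
  · have : inversions (1 : Equiv.Perm (Fin n)) = 0 := by
      rw [inversions, Finset.card_eq_zero, Finset.filter_eq_empty_iff]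
      rintro ⟨a, b⟩ - ⟨h₁, h₂⟩
      exact lt_asymm h₁ h₂
    simp [this]
  · intro σ _ hσ
    obtain ⟨i, hi⟩ := h σ hσ
    rw [List.prod_eq_zero, smul_zero]
    rw [List.mem_ofFn]
    exact ⟨i, hi⟩
  · simp

/-- A permutation with `i ≤ σ i` everywhere preserves the sum of the indices, so every inequality is
an equality. -/
theorem exists_apply_lt_of_ne_one {σ : Equiv.Perm (Fin n)} (hσ : σ ≠ 1) : ∃ i, σ i < i := by
  by_contra! h
  apply hσ
  have hsum : ∑ i, ((σ i : Fin n) : ℕ) = ∑ i : Fin n, (i : ℕ) := Equiv.sum_comp σ _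
  have := (Finset.sum_eq_sum_iff_of_le (s := Finset.univ)
    (f := fun i : Fin n => (i : ℕ)) (g := fun i => ((σ i : Fin n) : ℕ)) fun i _ => h i).1 hsum.symm
  ext i
  exact (this i (Finset.mem_univ i)).symm

theorem exists_lt_apply_of_ne_one {σ : Equiv.Perm (Fin n)} (hσ : σ ≠ 1) : ∃ i, i < σ i := by
  obtain ⟨i, hi⟩ := exists_apply_lt_of_ne_one (σ := σ⁻¹) (by simpa using hσ)
  exact ⟨σ⁻¹ i, by simpa using hi⟩

theorem IsBorelPoint.isSLPoint {M : Matrix (Fin n) (Fin n) T} (h : IsBorelPoint q M) :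
    IsSLPoint q M := by
  refine ⟨h.quantum.isMPoint, ?_⟩
  rw [qdet_of_support_one fun σ hσ => ?_, h.prod_diag]
  obtain ⟨i, hi⟩ := exists_apply_lt_of_ne_one hσ
  exact ⟨i, h.upper _ _ hi⟩

/-- The reversed matrix is lower triangular, so its determinant is the product of the diagonal in
the opposite order; the diagonal entries commute. -/
theorem IsBorelPoint.isSLPoint_reverse {M : Matrix (Fin n) (Fin n) T} (hq : q ≠ 0)
    (h : IsBorelPoint q⁻¹ M) : IsSLPoint q (M.submatrix Fin.rev Fin.rev) := by
  refine ⟨(h.quantum.reverse hq).isMPoint, ?_⟩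
  rw [qdet_of_support_one fun σ hσ => ?_]
  · have hperm : (List.ofFn fun i : Fin n => M i i).Perm
        (List.ofFn fun i => (M.submatrix Fin.rev Fin.rev) i i) :=
      (Equiv.Perm.ofFn_comp_perm Fin.revPerm fun i => M i i).symm
    rw [← hperm.prod_eq', h.prod_diag]
    rw [List.pairwise_ofFn]
    exact fun i j _ => h.commute_diag i j
  · obtain ⟨i, hi⟩ := exists_lt_apply_of_ne_one hσ
    exact ⟨i, h.upper _ _ (by simpa using hi)⟩

/-! ### The universal property of `SL_n^q` -/

theorem map_qdet {T' : Type} [Ring T'] [Algebra ℂ T'] (φ : T →ₐ[ℂ] T')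
    (M : Matrix (Fin n) (Fin n) T) : φ (qdet q M) = qdet q (M.map φ) := by
  simp [qdet, map_list_prod, List.map_ofFn, Function.comp_def]

theorem IsSLPoint.existsUnique_algHom {M : Matrix (Fin n) (Fin n) T} (h : IsSLPoint q M) :
    ∃! φ : SLq n q →ₐ[ℂ] T, ∀ i j, φ (SLq.gen n q i j) = M i j := by
  let f : FreeAlgebra ℂ (Fin n × Fin n) →ₐ[ℂ] T := FreeAlgebra.lift ℂ fun x => M x.1 x.2
  have hf : ∀ i j, f (freeMatrix n i j) = M i j := fun i j => by simp [f, freeMatrix]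
  have hrel : ∀ ⦃x y⦄, SLRel n q x y → f x = f y := by
    intro x y hxy
    cases hxy with
    | row₁ i j k m hij hkm => simpa [hf] using (h.1 i j k m hij hkm).1
    | row₂ i j k m hij hkm => simpa [hf] using (h.1 i j k m hij hkm).2.1
    | col₁ i j k m hij hkm => simpa [hf] using (h.1 i j k m hij hkm).2.2.1
    | col₂ i j k m hij hkm => simpa [hf] using (h.1 i j k m hij hkm).2.2.2.1
    | anti i j k m hij hkm => simpa [hf] using (h.1 i j k m hij hkm).2.2.2.2.1
    | diag i j k m hij hkm => simpa [hf] using (h.1 i j k m hij hkm).2.2.2.2.2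
    | det =>
      rw [map_qdet, map_one, ← h.2]
      congr 1
      ext i j
      exact hf i j
  refine ⟨RingQuot.liftAlgHom ℂ ⟨f, hrel⟩, fun i j => ?_, fun φ hφ => ?_⟩
  · rw [SLq.gen, RingQuot.liftAlgHom_mkAlgHom_apply, hf]
  · apply RingQuot.ringQuot_ext'
    apply FreeAlgebra.hom_ext
    funext x
    have h₁ := hφ x.1 x.2
    simp only [SLq.gen, freeMatrix, Matrix.of_apply] at h₁
    simp [h₁, f]

end QuantumMatrices

/-! ### Factorization of the classical matrices -/

section Classical

variable {A : Type} [CommRing A] {n : ℕ}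

theorem diagonal_pi_mul (d e : Fin n → A) :
    Matrix.diagonal (d * e) = Matrix.diagonal d * Matrix.diagonal e :=
  (Matrix.diagonal_mul_diagonal' d e).symm

/-- The diagonal of the edge-shearing matrix `S_k^edge(Z)`, where `Z = z ^ n`. -/
def edgeDiag (n k : ℕ) (z : Aˣ) : Fin n → A := fun i =>
  ((z ^ ((if (i : ℕ) < k then (n : ℤ) else 0) - k) : Aˣ) : A)

theorem edgeDiag_mul (k : ℕ) (z w : Aˣ) :
    edgeDiag n k (z * w) = edgeDiag n k z * edgeDiag n k w := by
  funext i
  simp [edgeDiag, mul_zpow]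

theorem edgeDiag_one (k : ℕ) : edgeDiag n k (1 : Aˣ) = 1 := by
  funext i
  simp [edgeDiag]

theorem edgeDiag_zero (z : Aˣ) : edgeDiag n 0 z = 1 := by
  funext i
  simp [edgeDiag]

theorem edgeDiag_self (z : Aˣ) : edgeDiag n n z = 1 := by
  funext i
  simp [edgeDiag]

theorem edgeShear_eq_diagonal (k : ℕ) (z : Aˣ) :
    edgeShear n k z = Matrix.diagonal (edgeDiag n k z) := by
  rw [edgeShear, ← Matrix.diagonal_smul]
  congr 1
  funext i
  simp only [edgeDiag, Pi.smul_apply, smul_eq_mul]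
  split_ifs
  · rw [sub_eq_neg_add, zpow_add, zpow_natCast, Units.val_mul, Units.val_pow_eq_pow_val]
  · simp

/-- The elementary matrix `1 + E_{k,k+1}`. -/
abbrev step (A : Type) [CommRing A] (n k : ℕ) : Matrix (Fin n) (Fin n) A := leftShear n k 1

theorem step_apply (k : ℕ) (i j : Fin n) :
    step A n k i j = if i = j then 1 else if (i : ℕ) + 1 = k ∧ (j : ℕ) = k then 1 else 0 := by
  simp [leftShear]

theorem leftShear_eq (k : ℕ) (x : Aˣ) :
    leftShear n (k + 1) x = Matrix.diagonal (edgeDiag n k x) * step A n (k + 1) := by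
  ext i j
  rw [Matrix.diagonal_mul, step_apply]
  simp only [leftShear, edgeDiag, Matrix.smul_apply, Matrix.of_apply, smul_eq_mul]
  rcases eq_or_ne i j with rfl | hij
  · simp only [if_true]
    by_cases h : (i : ℕ) < k
    · simp [h, sub_eq_neg_add, zpow_add]
    · simp [h]
  · by_cases h : (i : ℕ) = k
    · simp [hij, h]
    · simp [hij, h]

/-- The two products differ at most at `(k, k + 1)`, where the diagonal matrix contributes one or
the other of two neighbouring entries. -/
theorem commute_diagonal_step {k : ℕ} {d : Fin n → A}
    (h : ∀ i j : Fin n, (i : ℕ) + 1 = k → (j : ℕ) = k → d i = d j) :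
    Commute (Matrix.diagonal d) (step A n k) := by
  ext i j
  rw [Matrix.diagonal_mul, Matrix.mul_diagonal, step_apply]
  split_ifs with h₁ h₂
  · simp [h₁]
  · simp [h i j h₂.1 h₂.2]
  · simp

/-- The diagonal is a multiple of a fundamental coweight: it jumps only after position `j`, so it
commutes with every step other than the `j`-th. -/
theorem edgeDiag_eq_of_ne {j k : ℕ} (hjk : j ≠ k) (z : Aˣ) (i i' : Fin n) (hi : (i : ℕ) + 1 = k)
    (hi' : (i' : ℕ) = k) : edgeDiag n j z i = edgeDiag n j z i' := by
  have : (i : ℕ) < j ↔ (i' : ℕ) < j := by omega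
  simp [edgeDiag, this]

/-- The product of the steps `1, …, k`. -/
def steps (A : Type) [CommRing A] (n k : ℕ) : Matrix (Fin n) (Fin n) A :=
  ((List.Ico 1 (k + 1)).map fun a => step A n a).prod

theorem steps_zero : steps A n 0 = 1 := by simp [steps]

theorem list_Ico_succ {m k : ℕ} (h : m ≤ k) : List.Ico m (k + 1) = List.Ico m k ++ [k] := by
  rw [List.Ico.succ_top h]

theorem steps_succ (k : ℕ) : steps A n (k + 1) = steps A n k * step A n (k + 1) := by
  rw [steps, list_Ico_succ (by omega)]
  simp [steps]

theorem commute_diagonal_steps {k : ℕ} {d : Fin n → A}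
    (h : ∀ i j : Fin n, (i : ℕ) + 1 = j → (j : ℕ) ≤ k → d i = d j) :
    Commute (Matrix.diagonal d) (steps A n k) := by
  induction k with
  | zero => rw [steps_zero]; exact Commute.one_right _
  | succ k ih =>
    rw [steps_succ]
    exact (ih fun i j hi hj => h i j hi (by omega)).mul_right
      (commute_diagonal_step fun i j hi hj => h i j (by omega) (by omega))

/-- A block of the left matrix, completed by one edge-shearing matrix. -/
theorem leftBlock_mul (x : ℕ → Aˣ) (k : ℕ) (hk : 1 ≤ k) :
    (leftShear n 1 1 * ((List.Ico 2 (k + 1)).map fun l => leftShear n l (x (l - 1))).prod) *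
        Matrix.diagonal (edgeDiag n k (x k)) =
      steps A n k * Matrix.diagonal (∏ a ∈ Finset.range (k + 1), edgeDiag n a (x a)) := by
  induction k, hk using Nat.le_induction with
  | base => simp [steps, Finset.prod_range_succ, edgeDiag_zero]
  | succ k hk ih =>
    rw [list_Ico_succ (by omega), List.map_append, List.prod_append, List.map_singleton,
      List.prod_singleton, Nat.add_sub_cancel, leftShear_eq k (x k), ← mul_assoc, ← mul_assoc, ih,
      steps_succ, Finset.prod_range_succ _ (k + 1), mul_assoc (steps A n k),
      -- The diagonals accumulated so far have index at most `k` and pass the new step `k + 1`.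
      (commute_diagonal_step (k := k + 1) _).eq]
    · rw [mul_assoc, mul_assoc, diagonal_pi_mul, mul_assoc]
    · intro i j hi hj
      rw [Finset.prod_apply, Finset.prod_apply]
      refine Finset.prod_congr rfl fun a ha => edgeDiag_eq_of_ne ?_ _ i j hi hj
      have := Finset.mem_range.1 ha
      omega

theorem list_reverse_Ico_eq_map (n : ℕ) :
    (List.Ico 1 n).reverse = (List.Ico 1 n).map fun b => n - b := by
  apply List.ext_getElem
  · simp
  · intro i h₁ h₂
    simp only [List.length_reverse, List.Ico.length, List.length_map] at h₁ h₂
    simp [List.Ico]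
    omega

/-- The product of all `diag` of the edge-shearing matrices `S_a^edge(z_a)`. -/
def edgeProd (n : ℕ) (z : ℕ → Aˣ) : Fin n → A := ∏ a ∈ Finset.range (n + 1), edgeDiag n a (z a)

theorem edgeMatrix_eq (z : ℕ → Aˣ) : edgeMatrix n z = Matrix.diagonal (edgeProd n z) := by
  have h : ∀ l : List ℕ, (l.map fun a => edgeShear n a (z a)).prod =
      Matrix.diagonal ((l.map fun a => edgeDiag n a (z a)).prod) := by
    intro l
    induction l with
    | nil => simp
    | cons a l ih =>
      rw [List.map_cons, List.prod_cons, ih, edgeShear_eq_diagonal, ← diagonal_pi_mul,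
        List.map_cons, List.prod_cons]
  rw [edgeMatrix, h, edgeProd]
  congr 1
  have h₁ : ((List.Ico 1 n).map fun a => edgeDiag n a (z a)).prod =
      ∏ a ∈ Finset.Ico 1 n, edgeDiag n a (z a) := by
    rfl
  rw [h₁]
  refine Finset.prod_subset (fun a ha => ?_) fun a ha ha' => ?_
  · simp only [Finset.mem_Ico, Finset.mem_range] at ha ⊢
    omega
  · simp only [Finset.mem_Ico, Finset.mem_range] at ha ha'
    obtain rfl | rfl : a = 0 ∨ a = n := by omega
    · exact edgeDiag_zero _
    · exact edgeDiag_self _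

/-- The classical left matrix as a product of steps and diagonal matrices. -/
theorem edge_mul_left_mul_edge (x : ℕ → ℕ → Aˣ) (hx : ∀ a b, n < a + b → x a b = 1) :
    edgeMatrix n (fun a => x a 0) * leftMatrix n (fun a b _ => x a b) *
        edgeMatrix n (fun a => x a (n - a)) =
      Matrix.diagonal (edgeProd n fun a => x a 0) *
        ((List.Ico 1 n).map fun b =>
          steps A n (n - b) * Matrix.diagonal (edgeProd n fun a => x a b)).prod := by
  rw [edgeMatrix_eq, edgeMatrix_eq, mul_assoc]
  congr 1
  rw [leftMatrix, list_reverse_Ico_eq_map, List.map_map]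
  -- Invariant: up to the trivial index `n`, the factors of the last edge matrix with index above `n
  -- - m` are those that complete the first `m - 1` blocks.
  have key : ∀ m, 1 ≤ m → m ≤ n →
      ((List.Ico 1 m).map ((fun k => leftShear n 1 1 * ((List.Ico 2 (k + 1)).map fun l =>
        leftShear n l (x (l - 1) (n - k))).prod) ∘ fun b => n - b)).prod *
        Matrix.diagonal (∏ a ∈ Finset.Ico (n + 1 - m) (n + 1), edgeDiag n a (x a (n - a))) =
      ((List.Ico 1 m).map fun b =>
          steps A n (n - b) * Matrix.diagonal (edgeProd n fun a => x a b)).prod := by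
    intro m hm
    induction m, hm using Nat.le_induction with
    | base => intro _; simp [edgeDiag_self]
    | succ m hm ih =>
      intro hmn
      rw [list_Ico_succ hm, List.map_append, List.prod_append, List.map_append, List.prod_append,
        ← ih (by omega)]
      simp only [List.map_singleton, List.prod_singleton, Function.comp_apply]
      have hs : n + 1 - (m + 1) = n - m := by omega
      have hIco : Finset.Ico (n - m) (n + 1) = insert (n - m) (Finset.Ico (n + 1 - m) (n + 1)) := by
        ext a
        simp only [Finset.mem_Ico, Finset.mem_insert]
        omega
      rw [hs, hIco, Finset.prod_insert (by simp; omega), diagonal_pi_mul]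
      -- The factor of index `n - m` completes block `m`. Those of larger index commute with its
      -- steps and move left to the earlier blocks.
      have hb := leftBlock_mul (n := n) (fun a => x a m) (n - m) (by omega)
      rw [show n - (n - m) = m by omega, mul_assoc, ← mul_assoc _ (Matrix.diagonal _),
        hb, mul_assoc (_ : Matrix (Fin n) (Fin n) A) (Matrix.diagonal _) (_ * _),
        ← mul_assoc (Matrix.diagonal _) (steps A n (n - m)),
        (commute_diagonal_steps (k := n - m) _).eq]
      · simp only [mul_assoc]
        congr 2
        have : (edgeProd n fun a => x a m) =
            ∏ a ∈ Finset.range (n - m + 1), edgeDiag n a (x a m) := by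
          symm
          refine Finset.prod_subset (fun a ha => ?_) fun a ha ha' => ?_
          · simp only [Finset.mem_range] at ha ⊢
            omega
          · simp only [Finset.mem_range] at ha ha'
            rw [hx a m (by omega), edgeDiag_one]
        rw [this, ← diagonal_pi_mul, ← diagonal_pi_mul, mul_comm]
      · intro i j hi hj
        rw [Finset.prod_apply, Finset.prod_apply]
        refine Finset.prod_congr rfl fun a ha => edgeDiag_eq_of_ne ?_ _ i j hi rfl
        have := Finset.mem_Ico.1 ha
        omega
  rcases Nat.eq_zero_or_pos n with rfl | hn
  · ext i
    exact i.elim0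
  · rw [← key n hn le_rfl, show n + 1 - n = 1 by omega]
    congr 2
    rw [edgeProd]
    symm
    refine Finset.prod_subset (fun a ha => ?_) fun a ha ha' => ?_
    · simp only [Finset.mem_Ico, Finset.mem_range] at ha ⊢
      omega
    · simp only [Finset.mem_Ico, Finset.mem_range] at ha ha'
      obtain rfl : a = 0 := by omega
      exact edgeDiag_zero _

end Classical

/-! ### Elementary factors and the change of parameters -/

section ClassicalFactors

variable {A : Type} [CommRing A] {n : ℕ}

/-- The diagonal to the left of the step in an elementary factor. -/
def inDiag (n a : ℕ) (u y : Aˣ) : Fin n → A := edgeDiag n a (y * u ^ 2) * edgeDiag n (a + 1) u⁻¹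

/-- The diagonal to the right of the step in an elementary factor. -/
def outDiag (n a : ℕ) (u y : Aˣ) : Fin n → A := edgeDiag n a y⁻¹ * edgeDiag n (a - 1) u⁻¹

/-- The elementary factor of type `a`; only the entries `(a,a)`, `(a+1,a+1)`, `(a,a+1)` depend on
`u` and `y`. -/
def elementary (n a : ℕ) (u y : Aˣ) : Matrix (Fin n) (Fin n) A :=
  Matrix.diagonal (inDiag n a u y) * step A n a * Matrix.diagonal (outDiag n a u y)

/-- A block of elementary factors. -/
theorem prod_elementary (u y : ℕ → Aˣ) (hu : u 0 = 1) (hy : y 0 = 1) (k : ℕ) :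
    ((List.Ico 1 (k + 1)).map fun a => elementary n a (u a) (y a)).prod =
      Matrix.diagonal (∏ a ∈ Finset.range (k + 1), inDiag n a (u a) (y a)) * steps A n k *
        Matrix.diagonal (∏ a ∈ Finset.range (k + 1), outDiag n a (u a) (y a)) := by
  induction k with
  | zero => simp [steps_zero, hu, hy, inDiag, outDiag, edgeDiag_one]
  | succ k ih =>
    rw [list_Ico_succ (by omega), List.map_append, List.prod_append, List.map_singleton,
      List.prod_singleton, ih, elementary, Finset.prod_range_succ _ (k + 1),
      Finset.prod_range_succ _ (k + 1), steps_succ, diagonal_pi_mul, diagonal_pi_mul]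
    have h₁ : Commute (Matrix.diagonal (inDiag n (k + 1) (u (k + 1)) (y (k + 1))))
        (steps A n k) := commute_diagonal_steps fun i j hi hj => by
      simp only [inDiag, Pi.mul_apply]
      rw [edgeDiag_eq_of_ne (by omega) _ i j hi rfl, edgeDiag_eq_of_ne (by omega) _ i j hi rfl]
    have h₂ : Commute (Matrix.diagonal (∏ a ∈ Finset.range (k + 1), outDiag n a (u a) (y a)))
        (step A n (k + 1)) := commute_diagonal_step fun i j hi hj => by
      rw [Finset.prod_apply, Finset.prod_apply]
      refine Finset.prod_congr rfl fun a ha => ?_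
      have := Finset.mem_range.1 ha
      simp only [outDiag, Pi.mul_apply]
      rw [edgeDiag_eq_of_ne (by omega) _ i j hi hj, edgeDiag_eq_of_ne (by omega) _ i j hi hj]
    have h₃ := Matrix.commute_diagonal (∏ a ∈ Finset.range (k + 1), outDiag n a (u a) (y a))
      (inDiag n (k + 1) (u (k + 1)) (y (k + 1)))
    generalize Matrix.diagonal (∏ a ∈ Finset.range (k + 1), outDiag n a (u a) (y a)) = O at *
    generalize Matrix.diagonal (inDiag n (k + 1) (u (k + 1)) (y (k + 1))) = I at *
    simp only [mul_assoc]
    congr 1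
    rw [← mul_assoc O, h₃.eq, mul_assoc, ← mul_assoc O, h₂.eq, ← mul_assoc _ I, ← h₁.eq]
    simp only [mul_assoc]

/-- The coordinate at a vertex in terms of the parameters of the elementary factors. -/
def vertexParam (u y g : ℕ → ℕ → Aˣ) (a b : ℕ) : Aˣ :=
  (y a b)⁻¹ * (u (a + 1) b)⁻¹ * g a b * (y a (b + 1) * u a (b + 1) ^ 2) * (u (a - 1) (b + 1))⁻¹

variable {u y g : ℕ → ℕ → Aˣ}

/-- `vertexParam` collects the coefficients of the `a`-th coweight in the three diagonals meeting
between block `b` and block `b + 1`. The neighbours `a ± 1` appear because `inDiag` and `outDiag`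
carry `u` at shifted indices. -/
theorem edgeProd_vertexParam (hu : ∀ a b, a = 0 ∨ b = 0 ∨ n < a + b → u a b = 1) (b : ℕ) :
    edgeProd n (fun a => vertexParam u y g a b) =
      (∏ a ∈ Finset.range (n + 1), outDiag n a (u a b) (y a b)) *
        edgeProd n (fun a => g a b) *
        ∏ a ∈ Finset.range (n + 1), inDiag n a (u a (b + 1)) (y a (b + 1)) := by
  -- The end terms of the shifted products are trivial: coweights of index `0` and `n` vanish and `u
  -- n (b + 1) = 1`. The truncated `a - 1` at `a = 0` is therefore harmless.
  have h₁ : ∏ a ∈ Finset.range (n + 1), edgeDiag n a (u (a - 1) (b + 1))⁻¹ =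
      ∏ a ∈ Finset.range (n + 1), edgeDiag n (a + 1) (u a (b + 1))⁻¹ := by
    rw [Finset.prod_range_succ', Finset.prod_range_succ, edgeDiag_zero, hu n (b + 1) (by omega),
      inv_one, edgeDiag_one]
    rfl
  have h₂ : ∏ a ∈ Finset.range (n + 1), edgeDiag n a (u (a + 1) b)⁻¹ =
      ∏ a ∈ Finset.range (n + 1), edgeDiag n (a - 1) (u a b)⁻¹ := by
    rw [Finset.prod_range_succ, Finset.prod_range_succ', edgeDiag_self, edgeDiag_zero]
    rfl
  simp only [edgeProd, vertexParam, edgeDiag_mul, Finset.prod_mul_distrib, inDiag, outDiag, h₁, h₂]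
  ring

/-- Factorization of the classical left matrix into elementary factors and diagonal matrices. -/
theorem left_eq_prod_elementary (hu : ∀ a b, a = 0 ∨ b = 0 ∨ n < a + b → u a b = 1)
    (hy : ∀ a b, a = 0 ∨ b = 0 ∨ n < a + b → y a b = 1) (hg : ∀ a b, n < a + b → g a b = 1) :
    edgeMatrix n (fun a => vertexParam u y g a 0) *
        leftMatrix n (fun a b _ => vertexParam u y g a b) *
        edgeMatrix n (fun a => vertexParam u y g a (n - a)) =
      Matrix.diagonal (edgeProd n fun a => g a 0) *
        ((List.Ico 1 n).map fun b =>
          ((List.Ico 1 (n - b + 1)).map fun a => elementary n a (u a b) (y a b)).prod *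
            Matrix.diagonal (edgeProd n fun a => g a b)).prod := by
  rcases Nat.eq_zero_or_pos n with rfl | hn
  · ext i
    exact i.elim0
  have hx : ∀ a b, n < a + b → vertexParam u y g a b = 1 := by
    intro a b hab
    rw [vertexParam, hu (a + 1) b (by omega), hu a (b + 1) (by omega),
      hu (a - 1) (b + 1) (by omega), hy a b (by omega), hy a (b + 1) (by omega), hg a b hab]
    simp
  rw [edge_mul_left_mul_edge _ hx]
  -- The diagonal in front of block `m` already contains the `inDiag` of that block, which stays as
  -- last factor until the steps of the block arrive.
  have key : ∀ m, 1 ≤ m → m ≤ n →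
      Matrix.diagonal (edgeProd n fun a => vertexParam u y g a 0) *
        ((List.Ico 1 m).map fun b =>
          steps A n (n - b) * Matrix.diagonal (edgeProd n fun a => vertexParam u y g a b)).prod =
      Matrix.diagonal (edgeProd n fun a => g a 0) *
        ((List.Ico 1 m).map fun b =>
          ((List.Ico 1 (n - b + 1)).map fun a => elementary n a (u a b) (y a b)).prod *
            Matrix.diagonal (edgeProd n fun a => g a b)).prod *
        Matrix.diagonal (∏ a ∈ Finset.range (n + 1), inDiag n a (u a m) (y a m)) := by
    intro m hm
    induction m, hm using Nat.le_induction with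
    | base =>
      intro _
      have : ∏ a ∈ Finset.range (n + 1), outDiag n a (u a 0) (y a 0) = 1 :=
        Finset.prod_eq_one fun a _ => by
          simp [hu a 0, hy a 0, outDiag, edgeDiag_one]
      rw [edgeProd_vertexParam hu, this, one_mul, diagonal_pi_mul]
      simp
    | succ m hm ih =>
      intro hmn
      simp only [list_Ico_succ hm, List.map_append, List.prod_append, List.map_singleton,
        List.prod_singleton]
      rw [← mul_assoc, ih (by omega), edgeProd_vertexParam hu, diagonal_pi_mul, diagonal_pi_mul,
        prod_elementary (fun a => u a m) (fun a => y a m) (hu 0 m (by omega)) (hy 0 m (by omega))]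
      have hin : ∏ a ∈ Finset.range (n - m + 1), inDiag n a (u a m) (y a m) =
          ∏ a ∈ Finset.range (n + 1), inDiag n a (u a m) (y a m) := by
        refine Finset.prod_subset (fun a ha => ?_) fun a ha ha' => ?_
        · simp only [Finset.mem_range] at ha ⊢
          omega
        · simp only [Finset.mem_range] at ha ha'
          simp [hu a m (by omega), hy a m (by omega), inDiag, edgeDiag_one]
      have hout : ∏ a ∈ Finset.range (n - m + 1), outDiag n a (u a m) (y a m) =
          ∏ a ∈ Finset.range (n + 1), outDiag n a (u a m) (y a m) := by
        refine Finset.prod_subset (fun a ha => ?_) fun a ha ha' => ?_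
        · simp only [Finset.mem_range] at ha ⊢
          omega
        · simp only [Finset.mem_range] at ha ha'
          simp [hu a m (by omega), hy a m (by omega), outDiag, edgeDiag_one]
      rw [hin, hout]
      simp only [mul_assoc]
  rw [key n hn le_rfl]
  have : ∏ a ∈ Finset.range (n + 1), inDiag n a (u a n) (y a n) = 1 :=
    Finset.prod_eq_one fun a _ => by
      simp [hu a n (by omega), hy a n (by omega), inDiag, edgeDiag_one]
  rw [this, Matrix.diagonal_one', mul_one]

/-! ### Naturality and reversal -/

variable {A' : Type} [CommRing A']

theorem edgeShear_map (f : A →+* A') (k : ℕ) (z : Aˣ) :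
    (edgeShear n k z).map f = edgeShear n k (Units.map (f : A →* A') z) := by
  rw [edgeShear_eq_diagonal, edgeShear_eq_diagonal, Matrix.diagonal_map (map_zero f)]
  congr 1
  funext i
  simp only [edgeDiag, ← map_zpow, Units.coe_map, MonoidHom.coe_coe]

theorem leftShear_map (f : A →+* A') (k : ℕ) (z : Aˣ) :
    (leftShear n k z).map f = leftShear n k (Units.map (f : A →* A') z) := by
  ext i j
  simp only [leftShear, Matrix.map_apply, Matrix.smul_apply, Matrix.of_apply, smul_eq_mul, map_mul,
    ← map_zpow, Units.coe_map, MonoidHom.coe_coe, apply_ite f, map_pow, map_one, map_zero]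

theorem matrix_map_list_prod {ι : Type*} (f : A →+* A') (M : ι → Matrix (Fin n) (Fin n) A)
    (l : List ι) : ((l.map M).prod).map f = (l.map fun i => (M i).map f).prod := by
  have := map_list_prod f.mapMatrix (l.map M)
  simpa [List.map_map, Function.comp_def] using this

theorem edgeMatrix_map (f : A →+* A') (z : ℕ → Aˣ) :
    (edgeMatrix n z).map f = edgeMatrix n fun j => Units.map (f : A →* A') (z j) := by
  simp only [edgeMatrix, matrix_map_list_prod, edgeShear_map]

theorem leftMatrix_map (f : A →+* A') (x : ℕ → ℕ → ℕ → Aˣ) :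
    (leftMatrix n x).map f = leftMatrix n fun a b c => Units.map (f : A →* A') (x a b c) := by
  simp only [leftMatrix, matrix_map_list_prod, Matrix.map_mul, leftShear_map, map_one]

theorem edgeMatrix_congr {z w : ℕ → Aˣ} (h : ∀ j, 1 ≤ j → j < n → z j = w j) :
    edgeMatrix n z = edgeMatrix n w := by
  rw [edgeMatrix, edgeMatrix]
  congr 1
  refine List.map_congr_left fun j hj => ?_
  rw [List.Ico.mem] at hj
  rw [h j hj.1 hj.2]

theorem leftMatrix_congr {x x' : ℕ → ℕ → ℕ → Aˣ}
    (h : ∀ a b c, 1 ≤ a → 1 ≤ b → 1 ≤ c → a + b + c = n → x a b c = x' a b c) :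
    leftMatrix n x = leftMatrix n x' := by
  rw [leftMatrix, leftMatrix]
  congr 1
  refine List.map_congr_left fun k hk => ?_
  rw [List.mem_reverse, List.Ico.mem] at hk
  congr 2
  refine List.map_congr_left fun l hl => ?_
  rw [List.Ico.mem] at hl
  rw [h (l - 1) (n - k) (k + 1 - l) (by omega) (by omega) (by omega) (by omega)]

theorem submatrix_rev_mul (M N : Matrix (Fin n) (Fin n) A) :
    (M * N).submatrix Fin.rev Fin.rev =
      M.submatrix Fin.rev Fin.rev * N.submatrix Fin.rev Fin.rev :=
  (Matrix.submatrix_mul_equiv M N Fin.rev Fin.revPerm Fin.rev).symm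

theorem submatrix_rev_list_prod {ι : Type*} (M : ι → Matrix (Fin n) (Fin n) A) (l : List ι) :
    ((l.map M).prod).submatrix Fin.rev Fin.rev =
      (l.map fun i => (M i).submatrix Fin.rev Fin.rev).prod := by
  induction l with
  | nil => exact Matrix.submatrix_one_equiv Fin.revPerm
  | cons a l ih => rw [List.map_cons, List.prod_cons, submatrix_rev_mul, ih, List.map_cons,
      List.prod_cons]

theorem rightShear_eq_reverse (k : ℕ) (x : Aˣ) :
    rightShear n k x = (leftShear n k x⁻¹).submatrix Fin.rev Fin.rev := by
  ext i j
  have hi := i.2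
  have hj := j.2
  simp only [rightShear, leftShear, Matrix.submatrix_apply, Matrix.smul_apply, Matrix.of_apply,
    Fin.rev_inj, Fin.val_rev, inv_zpow', neg_neg, smul_eq_mul]
  congr 1
  have h₁ : n < (i : ℕ) + k ↔ n - (↑i + 1) + 1 < k := by omega
  have h₂ : (i : ℕ) + k = n ∧ (j : ℕ) + 1 = i ↔ n - (↑i + 1) + 1 = k ∧ n - (↑j + 1) = k := by omega
  simp only [h₁, h₂]

/-- Reversal sends the `k`-th fundamental coweight to minus the `(n - k)`-th. -/
theorem edgeShear_eq_reverse (k : ℕ) (hk : k ≤ n) (z : Aˣ) :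
    edgeShear n k z = (edgeShear n (n - k) z⁻¹).submatrix Fin.rev Fin.rev := by
  rw [edgeShear_eq_diagonal, edgeShear_eq_diagonal]
  ext i j
  simp only [Matrix.submatrix_apply, Matrix.diagonal_apply, Fin.rev_inj]
  refine if_congr Iff.rfl ?_ rfl
  have hi := i.2
  simp only [edgeDiag, inv_zpow', Fin.val_rev]
  congr 2
  by_cases h : (i : ℕ) < k
  · rw [if_pos h, if_neg (by omega)]
    push_cast [hk]
    ring
  · rw [if_neg h, if_pos (by omega)]
    push_cast [hk]
    ring

theorem rightMatrix_eq_reverse (x : ℕ → ℕ → ℕ → Aˣ) :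
    rightMatrix n x =
      (leftMatrix n fun a b c => (x c b a)⁻¹).submatrix Fin.rev Fin.rev := by
  rw [leftMatrix, submatrix_rev_list_prod, rightMatrix]
  congr 1
  refine List.map_congr_left fun k hk => ?_
  rw [List.mem_reverse, List.Ico.mem] at hk
  rw [submatrix_rev_mul, submatrix_rev_list_prod, rightShear_eq_reverse 1, inv_one]
  congr 2
  refine List.map_congr_left fun l hl => ?_
  rw [List.Ico.mem] at hl
  rw [rightShear_eq_reverse l]

theorem edgeMatrix_eq_reverse (z : ℕ → Aˣ) :
    edgeMatrix n z =
      (edgeMatrix n fun j => (z (n - j))⁻¹).submatrix Fin.rev Fin.rev := by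
  rw [edgeMatrix, edgeMatrix, submatrix_rev_list_prod]
  have h : ((List.Ico 1 n).map fun j => edgeShear n j (z j)).prod =
      ((List.Ico 1 n).reverse.map fun j => edgeShear n j (z j)).prod := by
    refine ((List.reverse_perm _).symm.map _).prod_eq' ?_
    rw [List.pairwise_map]
    refine List.pairwise_of_forall fun i j => ?_
    rw [edgeShear_eq_diagonal, edgeShear_eq_diagonal]
    exact Matrix.commute_diagonal _ _
  rw [h, list_reverse_Ico_eq_map, List.map_map]
  congr 1
  refine List.map_congr_left fun j hj => ?_
  rw [List.Ico.mem] at hj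
  rw [Function.comp_apply, edgeShear_eq_reverse (n - j) (by omega), show n - (n - j) = j by omega]

end ClassicalFactors

/-! ### Elementary quantum matrices -/

/-- An upper triangular matrix with diagonal `D` whose only other entry is `E` at `(a, a + 1)`. -/
def bidiagonal {T : Type*} [Zero T] {n : ℕ} (a : ℕ) (D : Fin n → T) (E : T) :
    Matrix (Fin n) (Fin n) T := Matrix.of fun i j =>
  if i = j then D i else if (i : ℕ) + 1 = a ∧ (j : ℕ) = a then E else 0

/-- In a `2 × 2` submatrix the product of the two antidiagonal entries is always zero: if the upper
right one is nonzero, the lower left one lies below the diagonal. The diagonal relation thus becomes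
plain commutation. -/
theorem bidiagonal_isBorelPoint {T : Type} [Ring T] [Algebra ℂ T] {n : ℕ} {q : ℂ} (a : ℕ)
    (D : Fin n → T) (E : T) (hD : ∀ i j, Commute (D i) (D j)) (hprod : (List.ofFn D).prod = 1)
    (h₁ : ∀ i : Fin n, (i : ℕ) + 1 = a → E * D i = q • (D i * E))
    (h₂ : ∀ i : Fin n, (i : ℕ) = a → D i * E = q • (E * D i))
    (h₃ : ∀ i : Fin n, (i : ℕ) + 1 ≠ a → (i : ℕ) ≠ a → Commute E (D i)) :
    IsBorelPoint q (bidiagonal a D E) where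
  quantum :=
    { row := fun i k m hkm => by
        simp only [bidiagonal, Matrix.of_apply]
        rcases eq_or_ne i k with rfl | hik
        · rw [if_pos rfl, if_neg hkm.ne]
          split_ifs with h
          · exact h₁ i h.1
          · simp
        · rw [if_neg hik]
          have := Fin.val_ne_of_ne hik
          split_ifs <;> first | simp | (exfalso; omega)
      col := fun i j k hij => by
        simp only [bidiagonal, Matrix.of_apply]
        rcases eq_or_ne j k with rfl | hjk
        · rw [if_pos rfl, if_neg hij.ne]
          split_ifs with h
          · exact h₂ j h.2
          · simp
        · rw [if_neg hjk]
          have := Fin.val_ne_of_ne hjk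
          split_ifs <;> first | simp | (exfalso; omega)
      anti := fun i j k m hij hkm => by
        simp only [bidiagonal, Matrix.of_apply]
        split_ifs <;> first | simp | (exfalso; omega)
      diag := fun i j k m hij hkm => by
        have h0 : bidiagonal a D E i m * bidiagonal a D E j k = 0 := by
          simp only [bidiagonal, Matrix.of_apply]
          split_ifs <;> first | simp | (exfalso; omega)
        rw [h0, smul_zero, sub_eq_zero]
        simp only [bidiagonal, Matrix.of_apply]
        split_ifs
        · exact hD j i
        · exact (h₃ j (by omega) (by omega)).symm
        · simp
        · exact h₃ i (by omega) (by omega)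
        · omega
        all_goals simp }
  upper i j hij := by
    simp only [bidiagonal, Matrix.of_apply]
    rw [if_neg hij.ne', if_neg]
    omega
  prod_diag := by simpa [bidiagonal] using hprod

/-! ### The regular representation of a twisted group algebra -/

section Twist

variable {W : Type} [AddCommGroup W] (B : W →ₗ[ℤ] W →ₗ[ℤ] ℤ) (η : ℂ)

/-- The action of the monomial `m` of the group algebra twisted by `B`. -/
def twistMono (m : W) : Module.End ℂ (W →₀ ℂ) :=
  Finsupp.linearCombination ℂ fun k => Finsupp.single (m + k) (η ^ B m k)

theorem twistMono_single (m k : W) (c : ℂ) :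
    twistMono B η m (Finsupp.single k c) = Finsupp.single (m + k) (c * η ^ B m k) := by
  simp [twistMono]

variable {η}

theorem twistMono_mul (hη : η ≠ 0) (m m' : W) :
    twistMono B η m * twistMono B η m' = η ^ B m m' • twistMono B η (m + m') := by
  refine Finsupp.lhom_ext fun k c => ?_
  simp only [Module.End.mul_apply, LinearMap.smul_apply, twistMono_single, map_add,
    LinearMap.add_apply, Finsupp.smul_single, smul_eq_mul]
  rw [zpow_add₀ hη, zpow_add₀ hη, add_assoc]
  congr 1
  ring

theorem twistMono_zero : twistMono B η (0 : W) = 1 := by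
  refine Finsupp.lhom_ext fun k c => ?_
  simp [twistMono_single]

theorem twistMono_mul_comm (hη : η ≠ 0) (hB : ∀ x y, B x y = -B y x) (m m' : W) :
    twistMono B η m * twistMono B η m' =
      η ^ (2 * B m m') • (twistMono B η m' * twistMono B η m) := by
  rw [twistMono_mul B hη, twistMono_mul B hη, smul_smul, ← zpow_add₀ hη, hB m' m, add_comm m']
  congr 2
  ring

theorem twistMono_list_prod (hη : η ≠ 0) {ι : Type*} (δ : ι → W) (h : ∀ i j, B (δ i) (δ j) = 0)
    (l : List ι) :
    (l.map fun i => twistMono B η (δ i)).prod = twistMono B η (l.map δ).sum := by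
  induction l with
  | nil => simp [twistMono_zero]
  | cons i l ih =>
    have : B (δ i) (l.map δ).sum = 0 := by
      rw [map_list_sum, List.map_map]
      exact List.sum_eq_zero fun x hx => by
        obtain ⟨j, -, rfl⟩ := List.mem_map.1 hx
        exact h i j
    rw [List.map_cons, List.prod_cons, ih, twistMono_mul B hη, this, zpow_zero, one_smul,
      List.map_cons, List.sum_cons]

variable (η)

/-- The linear map from Laurent polynomials to the regular representation of the twisted group
algebra. -/
def twist : AddMonoidAlgebra ℂ W →ₗ[ℂ] Module.End ℂ (W →₀ ℂ) :=
  Finsupp.linearCombination ℂ (twistMono B η) ∘ₗ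
    (AddMonoidAlgebra.coeffLinearEquiv ℂ).toLinearMap

theorem twist_single (m : W) (c : ℂ) :
    twist B η (AddMonoidAlgebra.single m c) = c • twistMono B η m := by
  simp [twist]

/-- The Laurent polynomials with exponents in a subgroup. -/
def supportedIn (S : AddSubgroup W) : Subalgebra ℂ (AddMonoidAlgebra ℂ W) :=
  (AddMonoidAlgebra.mapDomainAlgHom ℂ ℂ S.subtype).range

theorem single_mem_supportedIn {S : AddSubgroup W} {m : W} (hm : m ∈ S) (c : ℂ) :
    AddMonoidAlgebra.single m c ∈ supportedIn S :=
  ⟨AddMonoidAlgebra.single ⟨m, hm⟩ c, by simp⟩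

theorem supportedIn_induction {S : AddSubgroup W} {p : AddMonoidAlgebra ℂ W → Prop}
    (h0 : p 0) (hadd : ∀ f g, p f → p g → p (f + g))
    (hsingle : ∀ m ∈ S, ∀ c, p (AddMonoidAlgebra.single m c))
    {f : AddMonoidAlgebra ℂ W} (hf : f ∈ supportedIn S) : p f := by
  obtain ⟨f, rfl⟩ := hf
  induction f using AddMonoidAlgebra.induction_linear with
  | zero => simpa using h0
  | add f g hf hg => rw [map_add]; exact hadd _ _ hf hg
  | single m c => simpa using hsingle m m.2 c

theorem supportedIn_mono {S S' : AddSubgroup W} (h : S ≤ S') : supportedIn S ≤ supportedIn S' :=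
  fun _ hf => supportedIn_induction (zero_mem _) (fun _ _ => add_mem)
    (fun _ hm c => single_mem_supportedIn (h hm) c) hf

/-- The cocycle `η ^ B m m'` is trivial on orthogonal exponents, so here the ordering of a product
is the product of the orderings. -/
theorem twist_mul {S S' : AddSubgroup W} (hη : η ≠ 0) (h : ∀ x ∈ S, ∀ y ∈ S', B x y = 0)
    {f g : AddMonoidAlgebra ℂ W} (hf : f ∈ supportedIn S) (hg : g ∈ supportedIn S') :
    twist B η (f * g) = twist B η f * twist B η g := by
  refine supportedIn_induction (p := fun f => twist B η (f * g) = twist B η f * twist B η g)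
    (by simp) (fun f₁ f₂ h₁ h₂ => by simp only [add_mul, map_add, h₁, h₂]) (fun m hm c => ?_) hf
  refine supportedIn_induction (p := fun g => twist B η (AddMonoidAlgebra.single m c * g) =
      twist B η (AddMonoidAlgebra.single m c) * twist B η g)
    (by simp) (fun f₁ f₂ h₁ h₂ => by simp only [mul_add, map_add, h₁, h₂]) (fun m' hm' c' => ?_) hg
  rw [AddMonoidAlgebra.single_mul_single, twist_single, twist_single, twist_single,
    smul_mul_smul_comm, twistMono_mul B hη, h m hm m' hm', zpow_zero, one_smul]

theorem twist_commute {S S' : AddSubgroup W} (hη : η ≠ 0) (hB : ∀ x y, B x y = -B y x)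
    (h : ∀ x ∈ S, ∀ y ∈ S', B x y = 0)
    {f g : AddMonoidAlgebra ℂ W} (hf : f ∈ supportedIn S) (hg : g ∈ supportedIn S') :
    Commute (twist B η f) (twist B η g) := by
  rw [Commute, SemiconjBy, ← twist_mul B η hη h hf hg,
    ← twist_mul B η hη (fun y hy x hx => by rw [hB, h x hx y hy, neg_zero]) hg hf, mul_comm]

/-- A matrix of Laurent polynomials with exponents in `S` whose twist is a triangular point of
`SL_n^q`. -/
structure IsTwistedPoint {n : ℕ} (q : ℂ) (S : AddSubgroup W)
    (M : Matrix (Fin n) (Fin n) (AddMonoidAlgebra ℂ W)) : Prop where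
  mem : ∀ i j, M i j ∈ supportedIn S
  borel : IsBorelPoint q (M.map (twist B η))

/-! ### Products of twisted points and monomial bidiagonal matrices -/

variable {B η} {n : ℕ} {q : ℂ}

theorem IsTwistedPoint.mono {S S' : AddSubgroup W}
    {M : Matrix (Fin n) (Fin n) (AddMonoidAlgebra ℂ W)} (h : IsTwistedPoint B η q S M)
    (hS : S ≤ S') : IsTwistedPoint B η q S' M :=
  ⟨fun i j => supportedIn_mono hS (h.mem i j), h.borel⟩

theorem IsTwistedPoint.mul (hη : η ≠ 0) (hq : q ≠ 0) (hB : ∀ x y, B x y = -B y x)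
    {S S' : AddSubgroup W} {M N : Matrix (Fin n) (Fin n) (AddMonoidAlgebra ℂ W)}
    (h : ∀ x ∈ S, ∀ y ∈ S', B x y = 0) (hM : IsTwistedPoint B η q S M)
    (hN : IsTwistedPoint B η q S' N) : IsTwistedPoint B η q (S ⊔ S') (M * N) where
  mem i j := by
    rw [Matrix.mul_apply]
    exact sum_mem fun k _ => mul_mem (supportedIn_mono le_sup_left (hM.mem i k))
      (supportedIn_mono le_sup_right (hN.mem k j))
  borel := by
    have : (M * N).map (twist B η) = M.map (twist B η) * N.map (twist B η) := by
      ext1 i j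
      simp only [Matrix.map_apply, Matrix.mul_apply, map_sum]
      exact Finset.sum_congr rfl fun k _ => twist_mul B η hη h (hM.mem i k) (hN.mem k j)
    rw [this]
    exact hM.borel.mul hq hN.borel fun i j k l =>
      twist_commute B η hη hB h (hM.mem i j) (hN.mem k l)

theorem isTwistedPoint_one (S : AddSubgroup W) :
    IsTwistedPoint B η q S (1 : Matrix (Fin n) (Fin n) (AddMonoidAlgebra ℂ W)) where
  mem i j := by
    rw [Matrix.one_apply]
    split_ifs
    · exact one_mem _
    · exact zero_mem _
  borel := by
    -- The index `0` designates no off-diagonal position, so the identity is a bidiagonal matrix of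
    -- this type.
    have : (1 : Matrix (Fin n) (Fin n) (AddMonoidAlgebra ℂ W)).map (twist B η) =
        bidiagonal 0 (fun _ => 1) 0 := by
      ext1 i j
      simp only [Matrix.map_apply, Matrix.one_apply, bidiagonal, Matrix.of_apply]
      split_ifs <;> simp [AddMonoidAlgebra.one_def, twist_single, twistMono_zero] at *
    rw [this]
    apply bidiagonal_isBorelPoint <;> simp

theorem isTwistedPoint_list_prod (hη : η ≠ 0) (hq : q ≠ 0) (hB : ∀ x y, B x y = -B y x)
    {ι : Type*} (S : ι → AddSubgroup W) (M : ι → Matrix (Fin n) (Fin n) (AddMonoidAlgebra ℂ W))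
    (l : List ι) (hM : ∀ i ∈ l, IsTwistedPoint B η q (S i) (M i))
    (hl : l.Pairwise fun i j => ∀ x ∈ S i, ∀ y ∈ S j, B x y = 0) :
    IsTwistedPoint B η q (⨆ i ∈ l, S i) (l.map M).prod := by
  induction l with
  | nil => exact isTwistedPoint_one _
  | cons i l ih =>
    rw [List.pairwise_cons] at hl
    rw [List.map_cons, List.prod_cons]
    refine (IsTwistedPoint.mul hη hq hB (fun x hx y hy => ?_) (hM i (by simp))
      (ih (fun j hj => hM j (by simp [hj])) hl.2)).mono ?_
    · have hle : (⨆ j ∈ l, S j) ≤ (B x).toAddMonoidHom.ker :=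
        iSup₂_le fun j hj y hy => hl.1 j hj x hx y hy
      exact hle hy
    · refine sup_le (le_iSup₂_of_le i (by simp) le_rfl) (iSup₂_le fun j hj => ?_)
      exact le_iSup₂_of_le j (by simp [hj]) le_rfl

/-- The monomial matrices with a single entry off the diagonal. -/
theorem isTwistedPoint_bidiagonal (hη : η ≠ 0) (hB : ∀ x y, B x y = -B y x) {S : AddSubgroup W}
    (a : ℕ) (δ : Fin n → W) (ε : W) (hδS : ∀ i, δ i ∈ S) (hεS : ε ∈ S)
    (hδ : ∀ i j, B (δ i) (δ j) = 0) (hsum : ∑ i, δ i = 0) {c : ℤ} (hc : η ^ (2 * c) = q)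
    (hε : ∀ i : Fin n, B ε (δ i) =
      c * ((if (i : ℕ) + 1 = a then 1 else 0) - (if (i : ℕ) = a then 1 else 0))) :
    IsTwistedPoint B η q S (bidiagonal a (fun i => AddMonoidAlgebra.single (δ i) 1)
      (AddMonoidAlgebra.single ε 1)) where
  mem i j := by
    simp only [bidiagonal, Matrix.of_apply]
    split_ifs
    · exact single_mem_supportedIn (hδS i) 1
    · exact single_mem_supportedIn hεS 1
    · exact zero_mem _
  borel := by
    have : (bidiagonal a (fun i => AddMonoidAlgebra.single (δ i) (1 : ℂ))
        (AddMonoidAlgebra.single ε 1)).map (twist B η) =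
        bidiagonal a (fun i => twistMono B η (δ i)) (twistMono B η ε) := by
      ext1 i j
      simp only [Matrix.map_apply, bidiagonal, Matrix.of_apply, apply_ite (twist B η),
        twist_single, one_smul, map_zero]
    rw [this]
    refine bidiagonal_isBorelPoint a _ _ (fun i j => ?_) ?_ (fun i hi => ?_) (fun i hi => ?_)
      fun i hi hi' => ?_
    · rw [Commute, SemiconjBy, twistMono_mul_comm B hη hB, hδ, mul_zero, zpow_zero, one_smul]
    · rw [List.ofFn_eq_map, twistMono_list_prod B hη δ hδ, ← List.ofFn_eq_map, List.sum_ofFn, hsum,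
        twistMono_zero]
    · rw [twistMono_mul_comm B hη hB, hε, if_pos hi, if_neg (by omega), sub_zero, mul_one, hc]
    · rw [twistMono_mul_comm B hη hB, hB, hε, if_neg (by omega), if_pos hi]
      simp [hc]
    · rw [Commute, SemiconjBy, twistMono_mul_comm B hη hB, hε, if_neg hi, if_neg hi', sub_zero,
        mul_zero, mul_zero, zpow_zero, one_smul]

end Twist

/-! ### The lattice of parameters of the elementary factors -/

/-- The exponent lattice of the parameters `u_{ab}`, `y_{ab}` and of central parameters `g_{ab}`. -/
abbrev ParamLattice : Type := (ℕ × ℕ →₀ ℤ) × (ℕ × ℕ →₀ ℤ) × (ℕ × ℕ →₀ ℤ)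

/-- The standard scalar product of `ℤ^{ℕ × ℕ}`. -/
def dotForm : (ℕ × ℕ →₀ ℤ) →ₗ[ℤ] (ℕ × ℕ →₀ ℤ) →ₗ[ℤ] ℤ :=
  Finsupp.linearCombination ℤ fun p => Finsupp.lapply p

theorem dotForm_apply (x y : ℕ × ℕ →₀ ℤ) : dotForm x y = x.sum fun p r => r * y p := by
  simp [dotForm, Finsupp.linearCombination_apply, Finsupp.sum, LinearMap.sum_apply]

theorem dotForm_comm (x y : ℕ × ℕ →₀ ℤ) : dotForm x y = dotForm y x := by
  have : dotForm = dotForm.flip := by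
    ext p p'
    simp [dotForm, Finsupp.single_apply, eq_comm]
  rw [this, LinearMap.flip_apply, ← this]

/-- The commutation form: `y_{ab}` and `u_{ab}` form a canonical pair. -/
def paramForm : ParamLattice →ₗ[ℤ] ParamLattice →ₗ[ℤ] ℤ :=
  dotForm.compl₁₂ (LinearMap.fst ℤ _ _ ∘ₗ LinearMap.snd ℤ _ _) (LinearMap.fst ℤ _ _) -
    dotForm.compl₁₂ (LinearMap.fst ℤ _ _) (LinearMap.fst ℤ _ _ ∘ₗ LinearMap.snd ℤ _ _)

theorem paramForm_apply (w w' : ParamLattice) :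
    paramForm w w' = dotForm w.2.1 w'.1 - dotForm w.1 w'.2.1 := by
  simp [paramForm]

theorem paramForm_antisymm (w w' : ParamLattice) : paramForm w w' = -paramForm w' w := by
  rw [paramForm_apply, paramForm_apply, dotForm_comm w.1, dotForm_comm w.2.1]
  ring

/-- The exponents involving `u_p` and `y_p` only for `p ∈ Q`. -/
def paramSubgroup (Q : Set (ℕ × ℕ)) : AddSubgroup ParamLattice where
  carrier := {w | ∀ p, p ∉ Q → w.1 p = 0 ∧ w.2.1 p = 0}
  zero_mem' := by simp
  add_mem' := fun {x y} hx hy p hp => by simp [hx p hp, hy p hp]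
  neg_mem' := fun {x} hx p hp => by simp [hx p hp]

theorem paramSubgroup_mono {Q Q' : Set (ℕ × ℕ)} (h : Q ⊆ Q') :
    paramSubgroup Q ≤ paramSubgroup Q' := fun _ hw p hp => hw p fun hQ => hp (h hQ)

theorem paramForm_eq_zero {Q Q' : Set (ℕ × ℕ)} (h : Disjoint Q Q') :
    ∀ w ∈ paramSubgroup Q, ∀ w' ∈ paramSubgroup Q', paramForm w w' = 0 := by
  intro w hw w' hw'
  rw [paramForm_apply, dotForm_apply, dotForm_apply]
  have h' : ∀ p, (w.1 p = 0 ∧ w.2.1 p = 0) ∨ (w'.1 p = 0 ∧ w'.2.1 p = 0) := fun p => by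
    by_cases hp : p ∈ Q
    · exact Or.inr (hw' p fun hp' => Set.disjoint_left.1 h hp hp')
    · exact Or.inl (hw p hp)
  rw [Finsupp.sum, Finsupp.sum, Finset.sum_eq_zero, Finset.sum_eq_zero, sub_zero]
  · intro p _
    rcases h' p with h | h <;> simp [h]
  · intro p _
    rcases h' p with h | h <;> simp [h]

/-- The exponent of `u_{ab}`, zero outside the range of positions. -/
def uExp (n a b : ℕ) : ParamLattice :=
  if 1 ≤ a ∧ 1 ≤ b ∧ a + b ≤ n then (Finsupp.single (a, b) 1, 0, 0) else 0

/-- The exponent of `y_{ab}`, zero outside the range of positions. -/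
def yExp (n a b : ℕ) : ParamLattice :=
  if 1 ≤ a ∧ 1 ≤ b ∧ a + b ≤ n then (0, Finsupp.single (a, b) 1, 0) else 0

/-- The exponent of `g_{ab}`, zero outside the triangle. -/
def gExp (n a b : ℕ) : ParamLattice :=
  if a + b ≤ n then (0, 0, Finsupp.single (a, b) 1) else 0

theorem paramForm_y_u (n a b a' b' : ℕ) : paramForm (yExp n a b) (uExp n a' b') =
    if 1 ≤ a ∧ 1 ≤ b ∧ a + b ≤ n ∧ a = a' ∧ b = b' then 1 else 0 := by
  rw [paramForm_apply, yExp, uExp]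
  split_ifs <;> simp [dotForm, Finsupp.single_apply] <;> omega

theorem paramForm_u_u (n a b a' b' : ℕ) : paramForm (uExp n a b) (uExp n a' b') = 0 := by
  rw [paramForm_apply, uExp, uExp]
  split_ifs <;> simp

theorem paramForm_y_y (n a b a' b' : ℕ) : paramForm (yExp n a b) (yExp n a' b') = 0 := by
  rw [paramForm_apply, yExp, yExp]
  split_ifs <;> simp

theorem paramForm_g_left (n a b : ℕ) (w : ParamLattice) : paramForm (gExp n a b) w = 0 := by
  rw [paramForm_apply, gExp]
  split_ifs <;> simp

theorem paramForm_g_right (n a b : ℕ) (w : ParamLattice) : paramForm w (gExp n a b) = 0 := by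
  rw [paramForm_antisymm, paramForm_g_left, neg_zero]

/-- The exponent of the coordinate at the vertex `(a, b)`. -/
def xExp (n a b : ℕ) : ParamLattice :=
  -yExp n a b - uExp n (a + 1) b + gExp n a b + (yExp n a (b + 1) + (2 : ℤ) • uExp n a (b + 1))
    - uExp n (a - 1) (b + 1)

/-- The pairs `(a, b)` such that `(a, b, n - a - b)` is a vertex off the side `a = 0`. -/
def IsLeftVertex (n : ℕ) (p : ℕ × ℕ) : Prop := 1 ≤ p.1 ∧ p.1 < n ∧ p.1 + p.2 ≤ n

/-- The vertex `(a, b, n - a - b)`. -/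
def leftVertex {n : ℕ} {p : ℕ × ℕ} (h : IsLeftVertex n p) : Vertex n where
  a := p.1
  b := p.2
  c := n - p.1 - p.2
  sum_eq := by have := h.2.2; omega
  a_ne := by have := h.2.1; omega
  b_ne := by obtain ⟨_, _, _⟩ := h; omega
  c_ne := by obtain ⟨_, _, _⟩ := h; omega

/-- The reflection exchanging the first and the last coordinate. -/
def Vertex.reflect {n : ℕ} (v : Vertex n) : Vertex n where
  a := v.c
  b := v.b
  c := v.a
  sum_eq := by have := v.sum_eq; omega
  a_ne := v.c_ne
  b_ne := v.b_ne
  c_ne := v.a_ne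

/-! ### The quiver weights as pairings of parameters -/

theorem poisson_of_arrow {n : ℕ} {v w : Vertex n} (h : Arrow v w) {r : ℤ}
    (h₁ : SameSide v w → r = 1) (h₂ : ¬SameSide v w → r = 2) : poisson n v w = r := by
  rw [poisson, if_pos h]
  split_ifs with hs
  · exact (h₁ hs).symm
  · exact (h₂ hs).symm

theorem poisson_of_not_arrow {n : ℕ} {v w : Vertex n} (h₁ : ¬Arrow v w) (h₂ : ¬Arrow w v) :
    poisson n v w = 0 := by
  rw [poisson, if_neg h₁, if_neg h₂]

/-- The reflection reverses every arrow and permutes the sides of the triangle. -/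
theorem poisson_reflect {n : ℕ} (v w : Vertex n) :
    poisson n v.reflect w.reflect = -poisson n v w := by
  have harrow : ∀ v w : Vertex n, Arrow v.reflect w.reflect ↔ Arrow w v := fun v w => by
    simp only [Arrow, Vertex.reflect]
    omega
  have hside : ∀ v w : Vertex n, SameSide v.reflect w.reflect ↔ SameSide w v := fun v w => by
    simp only [SameSide, Vertex.reflect]
    omega
  have key : ∀ v w : Vertex n, Arrow w v → poisson n v.reflect w.reflect = poisson n w v := by
    intro v w h
    refine poisson_of_arrow ((harrow v w).2 h) (fun hs => ?_) fun hs => ?_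
    · exact poisson_of_arrow h (fun _ => rfl) fun hs' => absurd ((hside v w).1 hs) hs'
    · exact poisson_of_arrow h (fun hs' => absurd ((hside v w).2 hs') hs) fun _ => rfl
  rw [← poisson_antisymm]
  by_cases h₁ : Arrow w v
  · exact key v w h₁
  by_cases h₂ : Arrow v w
  · rw [poisson_antisymm, key w v h₂, ← poisson_antisymm]
  · rw [poisson_of_not_arrow (by rwa [harrow]) (by rwa [harrow]), poisson_of_not_arrow h₁ h₂]

/-- By bilinearity only pairings of a `y` with a `u` survive, six in each order. -/
theorem paramForm_xExp_expand (n a b a' b' : ℕ) : paramForm (xExp n a b) (xExp n a' b') =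
    paramForm (yExp n a b) (uExp n (a' + 1) b') - 2 * paramForm (yExp n a b) (uExp n a' (b' + 1)) +
    paramForm (yExp n a b) (uExp n (a' - 1) (b' + 1)) -
    paramForm (yExp n a (b + 1)) (uExp n (a' + 1) b') +
    2 * paramForm (yExp n a (b + 1)) (uExp n a' (b' + 1)) -
    paramForm (yExp n a (b + 1)) (uExp n (a' - 1) (b' + 1)) -
    (paramForm (yExp n a' b') (uExp n (a + 1) b) - 2 * paramForm (yExp n a' b') (uExp n a (b + 1)) +
    paramForm (yExp n a' b') (uExp n (a - 1) (b + 1)) -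
    paramForm (yExp n a' (b' + 1)) (uExp n (a + 1) b) +
    2 * paramForm (yExp n a' (b' + 1)) (uExp n a (b + 1)) -
    paramForm (yExp n a' (b' + 1)) (uExp n (a - 1) (b + 1))) := by
  simp only [xExp, map_add, map_sub, map_neg, map_smul, LinearMap.add_apply, LinearMap.sub_apply,
    LinearMap.neg_apply, LinearMap.smul_apply, paramForm_u_u, paramForm_y_y, paramForm_g_left,
    paramForm_g_right, paramForm_antisymm (uExp _ _ _) (yExp _ _ _), smul_eq_mul]
  ring

theorem paramForm_y_u_of_ne {n a b a' b' : ℕ} (h : a ≠ a' ∨ b ≠ b') :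
    paramForm (yExp n a b) (uExp n a' b') = 0 := by
  rw [paramForm_y_u, if_neg]
  omega

theorem paramForm_y_u_zero {n a a' b' : ℕ} : paramForm (yExp n a 0) (uExp n a' b') = 0 := by
  rw [paramForm_y_u, if_neg]
  omega

theorem paramForm_y_u_of_lt {n a b a' b' : ℕ} (h : n < a + b) :
    paramForm (yExp n a b) (uExp n a' b') = 0 := by
  rw [paramForm_y_u, if_neg]
  omega

theorem paramForm_y_u_self {n a b : ℕ} (h : 1 ≤ a ∧ 1 ≤ b ∧ a + b ≤ n) :
    paramForm (yExp n a b) (uExp n a b) = 1 := by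
  rw [paramForm_y_u, if_pos]
  omega

/-- The canonical pairs at `(a + 1, b)` and `(a, b + 1)` contribute one each. For `b = 0` the first
is absent, whence weight one on that side. -/
theorem paramForm_xExp_horizontal {n a b : ℕ} (ha : 1 ≤ a) (hb : 1 ≤ b) (h : a + 1 + b ≤ n) :
    paramForm (xExp n (a + 1) b) (xExp n a b) = 2 := by
  rw [paramForm_xExp_expand]
  simp (disch := omega) only [paramForm_y_u_self, paramForm_y_u_of_ne, Nat.add_sub_cancel]
  norm_num

theorem paramForm_xExp_bottom {n a : ℕ} (ha : 1 ≤ a) (h : a + 1 ≤ n) :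
    paramForm (xExp n (a + 1) 0) (xExp n a 0) = 1 := by
  rw [paramForm_xExp_expand]
  simp (disch := omega) only [paramForm_y_u_self, paramForm_y_u_of_ne, paramForm_y_u_zero,
    Nat.add_sub_cancel]
  norm_num

/-- The whole weight comes from the pair at `(a, b + 1)`: one coordinate contains `u²`, the other
`y⁻¹`. As `a ≥ 1`, such an arrow never lies on a side. -/
theorem paramForm_xExp_vertical {n a b : ℕ} (ha : 1 ≤ a) (h : a + b + 1 ≤ n) :
    paramForm (xExp n a b) (xExp n a (b + 1)) = 2 := by
  rw [paramForm_xExp_expand]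
  simp (disch := omega) only [paramForm_y_u_self, paramForm_y_u_of_ne]
  norm_num

theorem paramForm_xExp_diagonal {n a b : ℕ} (ha : 1 ≤ a) (h : a + 1 + b < n) :
    paramForm (xExp n a (b + 1)) (xExp n (a + 1) b) = 2 := by
  rw [paramForm_xExp_expand]
  simp (disch := omega) only [paramForm_y_u_self, paramForm_y_u_of_ne, Nat.add_sub_cancel]
  norm_num

/-- Of the two contributing pairs, the one at `(a + 1, b + 1)` lies outside the triangle. -/
theorem paramForm_xExp_side {n a b : ℕ} (ha : 1 ≤ a) (h : a + 1 + b = n) :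
    paramForm (xExp n a (b + 1)) (xExp n (a + 1) b) = 1 := by
  rw [paramForm_xExp_expand]
  simp (disch := omega) only [paramForm_y_u_self, paramForm_y_u_of_ne, paramForm_y_u_of_lt,
    Nat.add_sub_cancel]
  norm_num

theorem paramForm_xExp_of_arrow {n : ℕ} {p p' : ℕ × ℕ} (h : IsLeftVertex n p)
    (h' : IsLeftVertex n p') (harrow : Arrow (leftVertex h) (leftVertex h')) :
    poisson n (leftVertex h) (leftVertex h') = paramForm (xExp n p.1 p.2) (xExp n p'.1 p'.2) := by
  obtain ⟨a, b⟩ := p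
  obtain ⟨a', b'⟩ := p'
  have hv := h
  have hv' := h'
  simp only [IsLeftVertex] at hv hv'
  refine poisson_of_arrow harrow ?_ ?_
  all_goals
    simp only [SameSide, Arrow, leftVertex] at harrow ⊢
    clear h h'
    intro hs
    rcases harrow with ⟨e₁, e₂, -⟩ | ⟨e₁, e₂, -⟩ | ⟨e₁, e₂, -⟩
  · subst e₁ e₂
    obtain rfl : b' = 0 := by omega
    exact paramForm_xExp_bottom (by omega) (by omega)
  · omega
  · subst e₁ e₂
    exact paramForm_xExp_side (by omega) (by omega)
  · subst e₁ e₂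
    exact paramForm_xExp_horizontal (by omega) (by omega) (by omega)
  · subst e₁ e₂
    exact paramForm_xExp_vertical (by omega) (by omega)
  · subst e₁ e₂
    exact paramForm_xExp_diagonal (by omega) (by omega)

theorem paramForm_xExp_eq_zero {n a b a' b' : ℕ} (ha : 1 ≤ a) (ha' : 1 ≤ a')
    (h₀ : a ≠ a' ∨ b ≠ b') (h₁ : a' + 1 ≠ a ∨ b' ≠ b) (h₂ : a' ≠ a ∨ b' ≠ b + 1)
    (h₃ : a' ≠ a + 1 ∨ b' + 1 ≠ b) (h₁' : a + 1 ≠ a' ∨ b ≠ b') (h₂' : a ≠ a' ∨ b ≠ b' + 1)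
    (h₃' : a ≠ a' + 1 ∨ b + 1 ≠ b') : paramForm (xExp n a b) (xExp n a' b') = 0 := by
  rw [paramForm_xExp_expand]
  simp (disch := omega) only [paramForm_y_u_of_ne]
  norm_num

/-- The coordinates of the quantum torus satisfy the commutation relations of the parameters. -/
theorem poisson_leftVertex {n : ℕ} {p p' : ℕ × ℕ} (h : IsLeftVertex n p) (h' : IsLeftVertex n p') :
    poisson n (leftVertex h) (leftVertex h') = paramForm (xExp n p.1 p.2) (xExp n p'.1 p'.2) := by
  by_cases h₁ : Arrow (leftVertex h) (leftVertex h')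
  · exact paramForm_xExp_of_arrow h h' h₁
  by_cases h₂ : Arrow (leftVertex h') (leftVertex h)
  · rw [poisson_antisymm, paramForm_xExp_of_arrow h' h h₂, ← paramForm_antisymm]
  rw [poisson_of_not_arrow h₁ h₂]
  obtain ⟨a, b⟩ := p
  obtain ⟨a', b'⟩ := p'
  have hv := h
  have hv' := h'
  simp only [IsLeftVertex] at hv hv'
  by_cases he : a = a' ∧ b = b'
  · obtain ⟨rfl, rfl⟩ := he
    have := paramForm_antisymm (xExp n a b) (xExp n a b)
    dsimp only
    omega
  · simp only [Arrow, leftVertex] at h₁ h₂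
    clear h h'
    symm
    apply paramForm_xExp_eq_zero <;> omega

/-! ### Monomials as units -/

/-- The monomial of exponent `w` as a unit of the group algebra. -/
def mono {W : Type} [AddCommGroup W] : Multiplicative W →* (AddMonoidAlgebra ℂ W)ˣ :=
  (Units.map (AddMonoidAlgebra.of ℂ W)).comp (toUnits : Multiplicative W ≃* _).toMonoidHom

theorem coe_mono {W : Type} [AddCommGroup W] (w : W) :
    ((mono (Multiplicative.ofAdd w) : (AddMonoidAlgebra ℂ W)ˣ) : AddMonoidAlgebra ℂ W) =
      AddMonoidAlgebra.single w 1 := rfl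

theorem map_mono {W W' : Type} [AddCommGroup W] [AddCommGroup W'] (f : W →+ W') (w : W) :
    Units.map ((AddMonoidAlgebra.mapDomainRingHom ℂ f : _ →+* AddMonoidAlgebra ℂ W') : _ →* _)
      (mono (Multiplicative.ofAdd w)) = mono (Multiplicative.ofAdd (f w)) := by
  ext1
  simp [coe_mono]

/-- The exponent of the `i`-th diagonal entry of the `k`-th edge-shearing matrix. -/
def edgeWeight (n k : ℕ) (i : Fin n) : ℤ := (if (i : ℕ) < k then (n : ℤ) else 0) - k

theorem edgeDiag_mono {W : Type} [AddCommGroup W] (n k : ℕ) (w : W) (i : Fin n) :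
    edgeDiag n k (mono (Multiplicative.ofAdd w)) i =
      AddMonoidAlgebra.single (edgeWeight n k i • w) 1 := by
  rw [edgeDiag, ← map_zpow, ← ofAdd_zsmul, coe_mono, edgeWeight]

/-- The `k` weights `n - k` cancel the `n - k` weights `-k`. -/
theorem sum_edgeWeight {n k : ℕ} (hk : k ≤ n) : ∑ i : Fin n, edgeWeight n k i = 0 := by
  have h : (Finset.univ.filter fun i : Fin n => (i : ℕ) < k).card = k := by
    rw [Fin.card_filter_val_lt, min_eq_right hk]
  simp only [edgeWeight, Finset.sum_sub_distrib, Finset.sum_ite, Finset.sum_const, h]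
  simp [mul_comm]

theorem edgeProd_mono {W : Type} [AddCommGroup W] (n : ℕ) (g : ℕ → W) (i : Fin n) :
    edgeProd n (fun a => mono (Multiplicative.ofAdd (g a))) i =
      AddMonoidAlgebra.single (∑ a ∈ Finset.range (n + 1), edgeWeight n a i • g a) 1 := by
  rw [edgeProd, Finset.prod_apply]
  simp only [edgeDiag_mono]
  induction Finset.range (n + 1) using Finset.induction_on with
  | empty => simp [AddMonoidAlgebra.one_def]
  | insert a s ha ih =>
    rw [Finset.prod_insert ha, ih, Finset.sum_insert ha, AddMonoidAlgebra.single_mul_single,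
      one_mul]

/-- With `ω_k` for `edgeWeight n k`, the diagonal exponent of `u` is `2 ω_a - ω_{a+1} - ω_{a-1}`,
that is `n` times the simple coroot. The two contributions of `y` cancel on the diagonal and leave
`n` at `(a, a + 1)`. -/
theorem elementary_mono {W : Type} [AddCommGroup W] {n a : ℕ} (ha : 1 ≤ a) (u y : W) :
    elementary n a (mono (Multiplicative.ofAdd u)) (mono (Multiplicative.ofAdd y)) =
      bidiagonal a
        (fun i => AddMonoidAlgebra.single
          (((n : ℤ) * ((if (i : ℕ) + 1 = a then 1 else 0) - (if (i : ℕ) = a then 1 else 0))) • u) 1)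
        (AddMonoidAlgebra.single ((n : ℤ) • (y + u)) 1) := by
  have hin : ∀ i, inDiag n a (mono (Multiplicative.ofAdd u)) (mono (Multiplicative.ofAdd y)) i =
      AddMonoidAlgebra.single
        (edgeWeight n a i • (y + (2 : ℤ) • u) - edgeWeight n (a + 1) i • u) 1 := fun i => by
    rw [inDiag, Pi.mul_apply, ← map_inv, ← map_pow, ← map_mul, ← ofAdd_neg, ← ofAdd_nsmul,
      ← ofAdd_add, edgeDiag_mono, edgeDiag_mono, AddMonoidAlgebra.single_mul_single, one_mul]
    congr 1
    module
  have hout : ∀ i, outDiag n a (mono (Multiplicative.ofAdd u)) (mono (Multiplicative.ofAdd y)) i =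
      AddMonoidAlgebra.single (-(edgeWeight n a i • y) - edgeWeight n (a - 1) i • u) 1 :=
    fun i => by
    rw [outDiag, Pi.mul_apply, ← map_inv (mono (W := W)), ← map_inv (mono (W := W)),
      ← ofAdd_neg, ← ofAdd_neg, edgeDiag_mono, edgeDiag_mono, AddMonoidAlgebra.single_mul_single, one_mul]
    congr 1
    module
  ext1 i j
  rw [elementary, Matrix.mul_diagonal, Matrix.diagonal_mul, hin, hout, step_apply]
  simp only [bidiagonal, Matrix.of_apply]
  obtain ⟨a, rfl⟩ : ∃ a', a = a' + 1 := ⟨a - 1, by omega⟩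
  rw [Nat.add_sub_cancel]
  split_ifs with h₁ h₂ h₃ h₄ h₅
  all_goals try rw [mul_one, AddMonoidAlgebra.single_mul_single, one_mul]
  · omega
  · subst h₁
    congr 1
    have e₁ : edgeWeight n a i = -a := by rw [edgeWeight, if_neg (by omega)]; ring
    have e₂ : edgeWeight n (a + 1) i = n - (a + 1) := by
      rw [edgeWeight, if_pos (by omega)]; push_cast; ring
    have e₃ : edgeWeight n (a + 1 + 1) i = n - (a + 2) := by
      rw [edgeWeight, if_pos (by omega)]; push_cast; ring
    rw [e₁, e₂, e₃]
    module
  · subst h₁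
    congr 1
    have e₁ : edgeWeight n a i = -a := by rw [edgeWeight, if_neg (by omega)]; ring
    have e₂ : edgeWeight n (a + 1) i = - (a + 1) := by
      rw [edgeWeight, if_neg (by omega)]; push_cast; ring
    have e₃ : edgeWeight n (a + 1 + 1) i = n - (a + 2) := by
      rw [edgeWeight, if_pos (by omega)]; push_cast; ring
    rw [e₁, e₂, e₃]
    module
  · subst h₁
    congr 1
    -- Off the two special rows the second difference of `edgeWeight` in its index vanishes.
    have e : edgeWeight n a i + edgeWeight n (a + 1 + 1) i = 2 * edgeWeight n (a + 1) i := by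
      simp only [edgeWeight]
      by_cases h : (i : ℕ) < a
      · rw [if_pos h, if_pos (by omega), if_pos (by omega)]
        push_cast
        ring
      · rw [if_neg h, if_neg (by omega), if_neg (by omega)]
        push_cast
        ring
    rw [eq_sub_of_add_eq e]
    module
  · congr 1
    have e₁ : edgeWeight n a j = -a := by rw [edgeWeight, if_neg (by omega)]; ring
    have e₂ : edgeWeight n (a + 1) j = - (a + 1) := by
      rw [edgeWeight, if_neg (by omega)]; push_cast; ring
    have e₃ : edgeWeight n (a + 1) i = n - (a + 1) := by
      rw [edgeWeight, if_pos (by omega)]; push_cast; ring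
    have e₄ : edgeWeight n (a + 1 + 1) i = n - (a + 2) := by
      rw [edgeWeight, if_pos (by omega)]; push_cast; ring
    rw [e₁, e₂, e₃, e₄]
    module
  · rw [mul_zero, zero_mul]

theorem vertexParam_mono {W : Type} [AddCommGroup W] (u y g : ℕ → ℕ → W) (a b : ℕ) :
    vertexParam (fun a b => mono (Multiplicative.ofAdd (u a b)))
        (fun a b => mono (Multiplicative.ofAdd (y a b)))
        (fun a b => mono (Multiplicative.ofAdd (g a b))) a b =
      mono (Multiplicative.ofAdd (-y a b - u (a + 1) b + g a b +
        (y a (b + 1) + (2 : ℤ) • u a (b + 1)) - u (a - 1) (b + 1))) := by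
  simp only [vertexParam, ← map_inv (mono (W := W)), ← map_mul (mono (W := W)),
    ← map_pow (mono (W := W)), ← ofAdd_neg, ← ofAdd_add, ← ofAdd_nsmul]
  congr 2
  module

/-! ### The classical left matrix in the parameters is a twisted point -/

section TwistedLeft

variable {n : ℕ} {η q : ℂ}

theorem isTwistedPoint_edgeProd (hη : η ≠ 0) (hq : η ^ (2 * (n : ℤ) ^ 2) = q) (b : ℕ) :
    IsTwistedPoint paramForm η q (paramSubgroup ∅)
      (Matrix.diagonal (edgeProd n fun a => mono (Multiplicative.ofAdd (gExp n a b)))) := by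
  have h : Matrix.diagonal (edgeProd n fun a => mono (Multiplicative.ofAdd (gExp n a b))) =
      bidiagonal (n + 1) (fun i => AddMonoidAlgebra.single
        (∑ a ∈ Finset.range (n + 1), edgeWeight n a i • gExp n a b) 1)
        (AddMonoidAlgebra.single 0 1) := by
    ext1 i j
    simp only [Matrix.diagonal_apply, bidiagonal, Matrix.of_apply, edgeProd_mono]
    rw [if_neg (c := _ ∧ _)]
    omega
  have hg : ∀ a, gExp n a b ∈ paramSubgroup ∅ := fun a p _ => by
    rw [gExp]
    split_ifs <;> simp
  rw [h]
  refine isTwistedPoint_bidiagonal hη paramForm_antisymm _ _ _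
    (fun i => sum_mem fun a _ => zsmul_mem (hg a) _) (zero_mem _) (fun i j => ?_) ?_ hq fun i => ?_
  · simp [map_sum, LinearMap.sum_apply, paramForm_g_left]
  · rw [Finset.sum_comm]
    refine Finset.sum_eq_zero fun a ha => ?_
    rw [← Finset.sum_smul, sum_edgeWeight (by simpa [Nat.lt_succ_iff] using ha), zero_smul]
  · rw [if_neg (by omega), if_neg (by omega)]
    simp

/-- The exponent `n (y + u)` pairs with `n u` to `n²`, and exchanging two monomials costs twice
their pairing, so the factor is `η ^ (2 n²) = q`. -/
theorem isTwistedPoint_elementary (hη : η ≠ 0) (hq : η ^ (2 * (n : ℤ) ^ 2) = q) {a b : ℕ}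
    (ha : 1 ≤ a) (hb : 1 ≤ b) (hab : a + b ≤ n) :
    IsTwistedPoint paramForm η q (paramSubgroup {(a, b)})
      (elementary n a (mono (Multiplicative.ofAdd (uExp n a b)))
        (mono (Multiplicative.ofAdd (yExp n a b)))) := by
  have hu : uExp n a b ∈ paramSubgroup {(a, b)} := fun p hp => by
    rw [uExp]
    split_ifs <;> simp [Ne.symm hp]
  have hy : yExp n a b ∈ paramSubgroup {(a, b)} := fun p hp => by
    rw [yExp]
    split_ifs <;> simp [Ne.symm hp]
  rw [elementary_mono ha]
  refine isTwistedPoint_bidiagonal hη paramForm_antisymm _ _ _ (fun i => zsmul_mem hu _)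
    (zsmul_mem (add_mem hy hu) _) (fun i j => ?_) ?_ hq fun i => ?_
  · simp [paramForm_u_u]
  · rw [← Finset.sum_smul, ← Finset.mul_sum, Finset.sum_sub_distrib]
    have h₁ : ∑ i : Fin n, (if (i : ℕ) + 1 = a then (1 : ℤ) else 0) = 1 := by
      rw [Finset.sum_eq_single (⟨a - 1, by omega⟩ : Fin n)]
      · rw [if_pos (by simp; omega)]
      · intro i _ hi
        rw [if_neg]
        intro h
        exact hi (Fin.ext (by simp; omega))
      · simp
    have h₂ : ∑ i : Fin n, (if (i : ℕ) = a then (1 : ℤ) else 0) = 1 := by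
      rw [Finset.sum_eq_single (⟨a, by omega⟩ : Fin n)]
      · simp
      · intro i _ hi
        rw [if_neg]
        intro h
        exact hi (Fin.ext h)
      · simp
    rw [h₁, h₂, sub_self, mul_zero, zero_smul]
  · simp only [map_smul, map_add, LinearMap.smul_apply, LinearMap.add_apply, paramForm_u_u,
      paramForm_y_u_self ⟨ha, hb, hab⟩, smul_eq_mul]
    ring

/-- The classical left matrix, in terms of the parameters. -/
theorem isBorelPoint_twist_left (hη : η ≠ 0) (hq0 : q ≠ 0) (hq : η ^ (2 * (n : ℤ) ^ 2) = q) :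
    IsBorelPoint q ((edgeMatrix n (fun a => mono (Multiplicative.ofAdd (xExp n a 0))) *
        leftMatrix n (fun a b _ => mono (Multiplicative.ofAdd (xExp n a b))) *
        edgeMatrix n (fun a => mono (Multiplicative.ofAdd (xExp n a (n - a))))).map
          (twist paramForm η)) := by
  have hx : ∀ a b, mono (Multiplicative.ofAdd (xExp n a b)) =
      vertexParam (fun a b => mono (Multiplicative.ofAdd (uExp n a b)))
        (fun a b => mono (Multiplicative.ofAdd (yExp n a b)))
        (fun a b => mono (Multiplicative.ofAdd (gExp n a b))) a b :=
    fun a b => (vertexParam_mono (uExp n) (yExp n) (gExp n) a b).symm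
  simp only [hx]
  rw [left_eq_prod_elementary]
  · have hblock : ∀ b ∈ List.Ico 1 n, IsTwistedPoint paramForm η q
        (paramSubgroup {p | p.2 = b})
        (((List.Ico 1 (n - b + 1)).map fun a =>
          elementary n a (mono (Multiplicative.ofAdd (uExp n a b)))
            (mono (Multiplicative.ofAdd (yExp n a b)))).prod *
          Matrix.diagonal (edgeProd n fun a => mono (Multiplicative.ofAdd (gExp n a b)))) := by
      intro b hb
      rw [List.Ico.mem] at hb
      have h₁ : IsTwistedPoint paramForm η q (paramSubgroup {p | p.2 = b})
          ((List.Ico 1 (n - b + 1)).map fun a =>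
          elementary n a (mono (Multiplicative.ofAdd (uExp n a b)))
            (mono (Multiplicative.ofAdd (yExp n a b)))).prod := by
        refine (isTwistedPoint_list_prod hη hq0 paramForm_antisymm
          (fun a => paramSubgroup {(a, b)}) _ _ (fun a ha => ?_) ?_).mono ?_
        · rw [List.Ico.mem] at ha
          exact isTwistedPoint_elementary hη hq ha.1 hb.1 (by omega)
        · refine (List.Ico.nodup 1 (n - b + 1)).imp fun {a a'} h => paramForm_eq_zero ?_
          simpa using h
        · exact iSup₂_le fun a _ => paramSubgroup_mono (by simp)
      refine (h₁.mul hη hq0 paramForm_antisymm (paramForm_eq_zero ?_)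
        (isTwistedPoint_edgeProd hη hq b)).mono ?_
      · simp
      · exact sup_le le_rfl (paramSubgroup_mono (by simp))
    refine ((isTwistedPoint_edgeProd hη hq 0).mul hη hq0 paramForm_antisymm
      (S' := paramSubgroup Set.univ) (paramForm_eq_zero (by simp))
      ((isTwistedPoint_list_prod hη hq0 paramForm_antisymm
          (fun b => paramSubgroup {p | p.2 = b}) _ _ hblock ?_).mono ?_)).borel
    · refine (List.Ico.nodup 1 n).imp fun {b b'} h => paramForm_eq_zero ?_
      rw [Set.disjoint_left]
      rintro p rfl hp
      exact h hp
    · exact iSup₂_le fun b _ => paramSubgroup_mono (Set.subset_univ _)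
  · intro a b hab
    rw [uExp, if_neg (by omega), ofAdd_zero, map_one]
  · intro a b hab
    rw [yExp, if_neg (by omega), ofAdd_zero, map_one]
  · intro a b hab
    rw [gExp, if_neg (by omega), ofAdd_zero, map_one]

end TwistedLeft

/-! ### Transfer to the quantum torus -/

section Transfer

variable {G W T : Type} [AddCommGroup G] [AddCommGroup W] [Ring T] [Algebra ℂ T]
  {B : W →ₗ[ℤ] W →ₗ[ℤ] ℤ} {η : ℂ} {ι : G →+ W} {C : AddMonoidAlgebra ℂ G →ₗ[ℂ] T}
  {Ψ : (W →₀ ℂ) →ₗ[ℂ] T}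

theorem twist_mapDomain_mem (f : AddMonoidAlgebra ℂ G) {v : W →₀ ℂ}
    (hv : v ∈ LinearMap.range (Finsupp.lmapDomain ℂ ℂ ι)) :
    twist B η (AddMonoidAlgebra.mapDomainRingHom ℂ ι f) v ∈
      LinearMap.range (Finsupp.lmapDomain ℂ ℂ ι) := by
  obtain ⟨h, rfl⟩ := hv
  induction f using AddMonoidAlgebra.induction_linear with
  | zero => simp
  | add f g hf hg => rw [map_add, map_add, LinearMap.add_apply]; exact add_mem hf hg
  | single m c =>
    induction h using Finsupp.induction_linear with
    | zero => simp
    | add f g hf hg => rw [map_add, map_add]; exact add_mem hf hg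
    | single m' c' =>
      refine ⟨Finsupp.single (m + m') (c * (c' * η ^ B (ι m) (ι m'))), ?_⟩
      simp only [AddMonoidAlgebra.mapDomainRingHom_apply, AddMonoidAlgebra.mapDomain_single,
        twist_single, Finsupp.lmapDomain_apply, Finsupp.mapDomain_single, LinearMap.smul_apply,
        twistMono_single, Finsupp.smul_single, smul_eq_mul, map_add]

/-- On monomials both sides carry the same cocycle. Nothing is required of `Ψ` off the image of `ι`,
so membership of `v` in that span has to be tracked along products. -/
theorem twist_mapDomain_apply
    (hΨ : ∀ m, Ψ (Finsupp.single (ι m) 1) = C (AddMonoidAlgebra.single m 1))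
    (hmul : ∀ m m', C (AddMonoidAlgebra.single m 1) * C (AddMonoidAlgebra.single m' 1) =
      η ^ B (ι m) (ι m') • C (AddMonoidAlgebra.single (m + m') 1))
    (f : AddMonoidAlgebra ℂ G) {v : W →₀ ℂ}
    (hv : v ∈ LinearMap.range (Finsupp.lmapDomain ℂ ℂ ι)) :
    Ψ (twist B η (AddMonoidAlgebra.mapDomainRingHom ℂ ι f) v) = C f * Ψ v := by
  have hΨ' : ∀ m c, Ψ (Finsupp.single (ι m) c) = c • C (AddMonoidAlgebra.single m 1) :=
    fun m c => by rw [← hΨ, ← map_smul, Finsupp.smul_single, smul_eq_mul, mul_one]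
  have hC : ∀ m c, C (AddMonoidAlgebra.single m c) = c • C (AddMonoidAlgebra.single m 1) :=
    fun m c => by rw [← map_smul, AddMonoidAlgebra.smul_single, smul_eq_mul, mul_one]
  obtain ⟨h, rfl⟩ := hv
  induction f using AddMonoidAlgebra.induction_linear with
  | zero => simp
  | add f g hf hg =>
    rw [map_add, map_add, LinearMap.add_apply, map_add, hf, hg, map_add, add_mul]
  | single m c =>
    induction h using Finsupp.induction_linear with
    | zero => simp
    | add f g hf hg => simp only [map_add, mul_add, hf, hg]
    | single m' c' =>
      simp only [AddMonoidAlgebra.mapDomainRingHom_apply, AddMonoidAlgebra.mapDomain_single,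
        twist_single, Finsupp.lmapDomain_apply, Finsupp.mapDomain_single, LinearMap.smul_apply,
        twistMono_single, map_smul, ← map_add]
      rw [hΨ', hΨ', hC m c, smul_mul_smul_comm, hmul, smul_smul, smul_smul, mul_assoc]

/-- A twisted triangular point with exponents in the image of `ι` gives a point of `T`. -/
theorem IsBorelPoint.transfer {n : ℕ} {q : ℂ}
    (hΨ : ∀ m, Ψ (Finsupp.single (ι m) 1) = C (AddMonoidAlgebra.single m 1))
    (hone : C 1 = 1)
    (hmul : ∀ m m', C (AddMonoidAlgebra.single m 1) * C (AddMonoidAlgebra.single m' 1) =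
      η ^ B (ι m) (ι m') • C (AddMonoidAlgebra.single (m + m') 1))
    {M : Matrix (Fin n) (Fin n) (AddMonoidAlgebra ℂ G)}
    (h : IsBorelPoint q ((M.map (AddMonoidAlgebra.mapDomainRingHom ℂ ι)).map (twist B η))) :
    IsBorelPoint q (M.map C) := by
  have h0 : (Finsupp.single 0 1 : W →₀ ℂ) ∈ LinearMap.range (Finsupp.lmapDomain ℂ ℂ ι) :=
    ⟨Finsupp.single 0 1, by simp⟩
  have hΨ0 : Ψ (Finsupp.single 0 1) = 1 := by
    have := hΨ 0
    rwa [map_zero, ← AddMonoidAlgebra.one_def, hone] at this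
  -- Operators are read off from their value at the unit vector. `Φ` need not be multiplicative on
  -- all operators, but it is on products of the `τ f`, which is all that the relations involve.
  let Φ : Module.End ℂ (W →₀ ℂ) →ₗ[ℂ] T := Ψ ∘ₗ LinearMap.applyₗ (Finsupp.single 0 1)
  let τ := fun f => twist B η (AddMonoidAlgebra.mapDomainRingHom ℂ ι f)
  have hlist : ∀ l : List (AddMonoidAlgebra ℂ G), Φ (l.map τ).prod = (l.map C).prod := by
    intro l
    have : (l.map τ).prod (Finsupp.single 0 1) ∈ LinearMap.range (Finsupp.lmapDomain ℂ ℂ ι) ∧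
        Φ (l.map τ).prod = (l.map C).prod := by
      induction l with
      | nil => exact ⟨h0, hΨ0⟩
      | cons f l ih =>
        rw [List.map_cons, List.prod_cons]
        refine ⟨twist_mapDomain_mem f ih.1, ?_⟩
        rw [List.map_cons, List.prod_cons, ← ih.2]
        exact twist_mapDomain_apply hΨ hmul f ih.1
    exact this.2
  have h₁ : ∀ f, Φ (τ f) = C f := fun f => by simpa using hlist [f]
  have h₂ : ∀ f g, Φ (τ f * τ g) = C f * C g := fun f g => by simpa using hlist [f, g]
  refine ⟨⟨fun i k m hkm => ?_, fun i j k hij => ?_, fun i j k m hij hkm => ?_,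
    fun i j k m hij hkm => ?_⟩, fun i j hij => ?_, ?_⟩
  · have := congrArg Φ (h.quantum.row i k m hkm)
    rw [map_smul] at this
    simp only [Matrix.map_apply, ← h₂]
    exact this
  · have := congrArg Φ (h.quantum.col i j k hij)
    rw [map_smul] at this
    simp only [Matrix.map_apply, ← h₂]
    exact this
  · have := congrArg Φ (h.quantum.anti i j k m hij hkm)
    exact (h₂ _ _).symm.trans (this.trans (h₂ _ _))
  · have := congrArg Φ (h.quantum.diag i j k m hij hkm)
    rw [map_smul, map_sub] at this
    simp only [Matrix.map_apply, ← h₂]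
    exact this
  · have := congrArg Φ (h.upper i j hij)
    rw [map_zero] at this
    exact (h₁ _).symm.trans this
  · have := congrArg Φ h.prod_diag
    have hl := hlist (List.ofFn fun i => M i i)
    rw [List.map_ofFn, List.map_ofFn] at hl
    exact hl.symm.trans (this.trans hΨ0)

end Transfer

/-! ### The quantum left and right matrices -/

section Points

open Classical in
/-- The exponents of the coordinates in terms of the parameters. -/
def paramMap (n : ℕ) : (ℕ × ℕ →₀ ℤ) →ₗ[ℤ] ParamLattice :=
  Finsupp.linearCombination ℤ fun p => if IsLeftVertex n p then xExp n p.1 p.2 else 0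

open Classical in
/-- The exponents of the coordinates at the vertices off the side `a = 0`. -/
def leftMap (n : ℕ) : (ℕ × ℕ →₀ ℤ) →ₗ[ℤ] (Vertex n →₀ ℤ) :=
  Finsupp.linearCombination ℤ fun p =>
    if h : IsLeftVertex n p then Finsupp.single (leftVertex h) 1 else 0

open Classical in
/-- The exponents of the inverse coordinates at the reflected vertices. -/
def rightMap (n : ℕ) : (ℕ × ℕ →₀ ℤ) →ₗ[ℤ] (Vertex n →₀ ℤ) :=
  Finsupp.linearCombination ℤ fun p =>
    if h : IsLeftVertex n p then Finsupp.single (leftVertex h).reflect (-1) else 0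

theorem exponentForm_leftMap (n : ℕ) (m m' : ℕ × ℕ →₀ ℤ) :
    exponentForm (poisson n) (leftMap n m) (leftMap n m') =
      paramForm (paramMap n m) (paramMap n m') := by
  suffices h : (exponentForm (poisson n)).compl₁₂ (leftMap n) (leftMap n) =
      paramForm.compl₁₂ (paramMap n) (paramMap n) from LinearMap.congr_fun₂ h m m'
  ext p p'
  simp only [LinearMap.compl₁₂_apply, LinearMap.comp_apply, Finsupp.lsingle_apply, leftMap,
    paramMap, Finsupp.linearCombination_single, one_smul]
  by_cases h : IsLeftVertex n p
  · by_cases h' : IsLeftVertex n p'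
    · simp [h, h', exponentForm_single, poisson_leftVertex]
    · simp [h']
  · simp [h]

/-- The sign comes from the reflection; the two inversions of coordinates cancel. -/
theorem exponentForm_rightMap (n : ℕ) (m m' : ℕ × ℕ →₀ ℤ) :
    exponentForm (poisson n) (rightMap n m) (rightMap n m') =
      -paramForm (paramMap n m) (paramMap n m') := by
  suffices h : (exponentForm (poisson n)).compl₁₂ (rightMap n) (rightMap n) =
      -paramForm.compl₁₂ (paramMap n) (paramMap n) from LinearMap.congr_fun₂ h m m'
  ext p p'
  simp only [LinearMap.compl₁₂_apply, LinearMap.comp_apply, Finsupp.lsingle_apply, rightMap,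
    paramMap, Finsupp.linearCombination_single, one_smul, LinearMap.neg_apply]
  by_cases h : IsLeftVertex n p
  · by_cases h' : IsLeftVertex n p'
    · simp [h, h', exponentForm_single, poisson_reflect, poisson_leftVertex]
    · simp [h']
  · simp [h]

/-- The central part of an exponent of the parameters. -/
def centralPart : ParamLattice →ₗ[ℤ] (ℕ × ℕ →₀ ℤ) := LinearMap.snd ℤ _ _ ∘ₗ LinearMap.snd ℤ _ _

/-- Each coordinate contains its own `g_{ab}` exactly once and no other, so the central part
recovers the exponent. -/
theorem centralPart_paramMap {n : ℕ} {N : Type} [AddCommGroup N] (κ : (ℕ × ℕ →₀ ℤ) →ₗ[ℤ] N)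
    (hκ : ∀ p, ¬IsLeftVertex n p → κ (Finsupp.single p 1) = 0) (m : ℕ × ℕ →₀ ℤ) :
    κ (centralPart (paramMap n m)) = κ m := by
  suffices h : κ ∘ₗ centralPart ∘ₗ paramMap n = κ from LinearMap.congr_fun h m
  ext p
  simp only [LinearMap.comp_apply, Finsupp.lsingle_apply, paramMap,
    Finsupp.linearCombination_single, one_smul]
  by_cases h : IsLeftVertex n p
  · have hu : ∀ a b, centralPart (uExp n a b) = 0 := fun a b => by
      rw [uExp]; split_ifs <;> simp [centralPart]
    have hy : ∀ a b, centralPart (yExp n a b) = 0 := fun a b => by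
      rw [yExp]; split_ifs <;> simp [centralPart]
    have hg : centralPart (gExp n p.1 p.2) = Finsupp.single p 1 := by
      rw [gExp, if_pos h.2.2]; simp [centralPart]
    rw [if_pos h, xExp]
    simp [hu, hy, hg]
  · rw [if_neg h, map_zero, map_zero, hκ p h]

/-- The classical left matrix in the coordinates `x_{ab}`. -/
def genericLeft (n : ℕ) : Matrix (Fin n) (Fin n) (AddMonoidAlgebra ℂ (ℕ × ℕ →₀ ℤ)) :=
  edgeMatrix n (fun a => mono (Multiplicative.ofAdd (Finsupp.single (a, 0) 1))) *
    leftMatrix n (fun a b _ => mono (Multiplicative.ofAdd (Finsupp.single (a, b) 1))) *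
    edgeMatrix n (fun a => mono (Multiplicative.ofAdd (Finsupp.single (a, n - a) 1)))

theorem genericLeft_map {n : ℕ} {N : Type} [AddCommGroup N] (κ : (ℕ × ℕ →₀ ℤ) →+ N)
    (x : ℕ → ℕ → ℕ → (AddMonoidAlgebra ℂ N)ˣ)
    (h : ∀ a b c, a + b + c = n → 1 ≤ a → a < n →
      mono (Multiplicative.ofAdd (κ (Finsupp.single (a, b) 1))) = x a b c) :
    (genericLeft n).map (AddMonoidAlgebra.mapDomainRingHom ℂ κ) =
      edgeMatrix n (fun a => x a 0 (n - a)) * leftMatrix n x *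
        edgeMatrix n (fun a => x a (n - a) 0) := by
  rw [genericLeft, Matrix.map_mul, Matrix.map_mul, edgeMatrix_map, edgeMatrix_map, leftMatrix_map]
  simp only [map_mono]
  rw [edgeMatrix_congr (w := fun a => x a 0 (n - a))
      fun a ha ha' => h a 0 (n - a) (by omega) ha ha',
    leftMatrix_congr (x' := x) fun a b c ha hb hc habc => h a b c habc ha (by omega),
    edgeMatrix_congr (w := fun a => x a (n - a) 0)
      fun a ha ha' => h a (n - a) 0 (by omega) ha ha']

/-- Keeping `η₀` separate from `η` lets one lattice computation serve both matrices: `η₀ = η` on the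
left, `η₀ = η⁻¹` on the right. -/
theorem genericLeft_transfer {n : ℕ} {q ω η η₀ : ℂ} (hη : η ≠ 0) (hω : η ^ 2 = ω)
    (hη₀ : η₀ ≠ 0) (hq₀ : q ≠ 0) (hq : η₀ ^ (2 * (n : ℤ) ^ 2) = q)
    (κ : (ℕ × ℕ →₀ ℤ) →ₗ[ℤ] (Vertex n →₀ ℤ))
    (hκ : ∀ p, ¬IsLeftVertex n p → κ (Finsupp.single p 1) = 0)
    (hform : ∀ m m', η ^ exponentForm (poisson n) (κ m) (κ m') =
      η₀ ^ paramForm (paramMap n m) (paramMap n m')) :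
    IsBorelPoint q (((genericLeft n).map
      (AddMonoidAlgebra.mapDomainRingHom ℂ (κ : (ℕ × ℕ →₀ ℤ) →+ (Vertex n →₀ ℤ)))).map
        (weyl (poisson n) ω η)) := by
  let C : AddMonoidAlgebra ℂ (ℕ × ℕ →₀ ℤ) →ₗ[ℂ] FGTorus n ω :=
    weyl (poisson n) ω η ∘ₗ AddMonoidAlgebra.mapDomainLinearMap ℂ ℂ κ
  let Ψ : (ParamLattice →₀ ℂ) →ₗ[ℂ] FGTorus n ω := Finsupp.linearCombination ℂ fun w =>
    weylWord (poisson n) ω η (canonicalWord (κ (centralPart w)))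
  have hC : ∀ m, C (AddMonoidAlgebra.single m 1) =
      weylWord (poisson n) ω η (canonicalWord (κ m)) := fun m => by
    simp [C, weyl_single]
  change IsBorelPoint q ((genericLeft n).map C)
  refine IsBorelPoint.transfer (B := paramForm) (η := η₀) (Ψ := Ψ)
    (ι := (paramMap n : (ℕ × ℕ →₀ ℤ) →+ ParamLattice)) (fun m => ?_) ?_ (fun m m' => ?_) ?_
  · simp [Ψ, hC, centralPart_paramMap κ hκ]
  · rw [AddMonoidAlgebra.one_def, hC, map_zero, weylWord_canonicalWord_zero]
  · rw [hC, hC, hC, weylWord_canonicalWord_mul ω η (poisson_antisymm n) hη hω, hform, map_add]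
    rfl
  · rw [genericLeft_map _ (fun a b _ => mono (Multiplicative.ofAdd (xExp n a b)))]
    · exact isBorelPoint_twist_left hη₀ hq₀ hq
    · intro a b c habc ha ha'
      have : IsLeftVertex n (a, b) := ⟨ha, ha', by dsimp only; omega⟩
      simp [paramMap, this]

theorem coord_eq {n a b c : ℕ} (v : Vertex n) (ha : v.a = a) (hb : v.b = b) (hc : v.c = c) :
    coord n a b c = mono (Multiplicative.ofAdd (Finsupp.single v 1)) := by
  subst ha hb hc
  rw [coord, dif_pos ⟨v.sum_eq, v.a_ne, v.b_ne, v.c_ne⟩]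
  exact Units.ext rfl

theorem isBorelPoint_quantumLeft {n : ℕ} {q ω η : ℂ} (hη : η ≠ 0) (hω : η ^ 2 = ω)
    (hq₀ : q ≠ 0) (hq : η ^ (2 * (n : ℤ) ^ 2) = q) : IsBorelPoint q (quantumLeft n ω η) := by
  rw [quantumLeft, ← genericLeft_map (leftMap n : (ℕ × ℕ →₀ ℤ) →+ (Vertex n →₀ ℤ))]
  · exact genericLeft_transfer hη hω hη hq₀ hq (leftMap n) (fun p hp => by simp [leftMap, hp])
      fun m m' => by rw [exponentForm_leftMap]
  · intro a b c habc ha ha'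
    have h : IsLeftVertex n (a, b) := ⟨ha, ha', by dsimp only; omega⟩
    rw [coord_eq (a := a) (b := b) (c := c) (leftVertex h) rfl rfl (by simp [leftVertex]; omega)]
    simp [leftMap, h]

theorem isSLPoint_quantumRight {n : ℕ} {q ω η : ℂ} (hη : η ≠ 0) (hω : η ^ 2 = ω)
    (hq₀ : q ≠ 0) (hq : η ^ (2 * (n : ℤ) ^ 2) = q) : IsSLPoint q (quantumRight n ω η) := by
  -- The negated form is absorbed into `η⁻¹`, which replaces `q` by `q⁻¹`; reversing the matrix
  -- undoes this.
  have h := genericLeft_transfer hη hω (inv_ne_zero hη) (inv_ne_zero hq₀)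
    (by rw [inv_zpow, hq]) (rightMap n) (fun p hp => by simp [rightMap, hp])
    fun m m' => by rw [exponentForm_rightMap, inv_zpow, zpow_neg]
  rw [genericLeft_map _ (fun a b c => (coord n c b a)⁻¹)] at h
  · have := h.isSLPoint_reverse hq₀
    rw [Matrix.submatrix_map, submatrix_rev_mul, submatrix_rev_mul,
      ← rightMatrix_eq_reverse] at this
    have h₁ : edgeMatrix n (fun j => coord n j 0 (n - j)) =
        (edgeMatrix n fun a => (coord n (n - a) 0 a)⁻¹).submatrix Fin.rev Fin.rev := by
      rw [edgeMatrix_eq_reverse]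
      refine congrArg (fun M => Matrix.submatrix M Fin.rev Fin.rev)
        (edgeMatrix_congr fun a ha ha' => ?_)
      rw [show n - (n - a) = a by omega]
    have h₂ : edgeMatrix n (fun j => coord n 0 j (n - j)) =
        (edgeMatrix n fun a => (coord n 0 (n - a) a)⁻¹).submatrix Fin.rev Fin.rev := by
      rw [edgeMatrix_eq_reverse]
      refine congrArg (fun M => Matrix.submatrix M Fin.rev Fin.rev)
        (edgeMatrix_congr fun a ha ha' => ?_)
      rw [show n - (n - a) = a by omega]
    rw [quantumRight, h₁, h₂]
    exact this
  · intro a b c habc ha ha'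
    have h : IsLeftVertex n (a, b) := ⟨ha, ha', by dsimp only; omega⟩
    rw [coord_eq (a := c) (b := b) (c := a) (leftVertex h).reflect
        (by simp [leftVertex, Vertex.reflect]; omega) rfl rfl,
      ← map_inv, ← ofAdd_neg, ← Finsupp.single_neg]
    simp [rightMap, h]

end Points

end FockGoncharov

end

theorem theorem1 (n : ℕ) (hn : 2 ≤ n) (q ω η : ℂ) (hq : q ≠ 0) (hω : ω ^ (n ^ 2) = q)
    (hη : η ^ 2 = ω) :
    FockGoncharov.IsSLPoint q (FockGoncharov.quantumLeft n ω η) ∧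
    FockGoncharov.IsSLPoint q (FockGoncharov.quantumRight n ω η) ∧
    (∃! φ : FockGoncharov.SLq n q →ₐ[ℂ] FockGoncharov.FGTorus n ω,
      ∀ i j, φ (FockGoncharov.SLq.gen n q i j) = FockGoncharov.quantumLeft n ω η i j) ∧
    (∃! φ : FockGoncharov.SLq n q →ₐ[ℂ] FockGoncharov.FGTorus n ω,
      ∀ i j, φ (FockGoncharov.SLq.gen n q i j) = FockGoncharov.quantumRight n ω η i j) := by
  have hη₀ : η ≠ 0 := by
    rintro rfl
    apply hq
    rw [← hω, ← hη, zero_pow two_ne_zero, zero_pow (by positivity)]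
  have hq' : η ^ (2 * (n : ℤ) ^ 2) = q := by
    rw [← hω, ← hη, ← pow_mul]
    exact_mod_cast zpow_natCast η (2 * n ^ 2)
  have hL := (FockGoncharov.isBorelPoint_quantumLeft hη₀ hη hq hq').isSLPoint
  have hR := FockGoncharov.isSLPoint_quantumRight hη₀ hη hq hq'
  exact ⟨hL, hR, hL.existsUnique_algHom, hR.existsUnique_algHom⟩
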